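/- Let $d\ge 3$, write $g(x,y)=|x-y|^{-(d-2)}$ for the Coulomb kernel on $\mathbb{R}^d$ (with $g(x,x)=+\infty$) and, for $n\ge 1$ and $\zeta>0$, $K_\zeta(x,y)=K_{\zeta,n}(x,y)=\bigl(|x-y|^2+n^{-2\zeta}\bigr)^{-(d-2)/2}$. For a kernel $K$ with values in $[0,\infty]$ and a probability measure $\mu$ on $\mathbb{R}^d$, put $U_K^\mu(z)=\int K(z,x)\,d\mu(x)$. Let $V:\mathbb{R}^d\to[0,\infty)$ be of class $C^2$ with uniformly bounded second-order derivatives, with $V(x)\to+\infty$ as $|x|\to\infty$ and $\int e^{-c'V(x)}\,dx<\infty$ for some $c'>0$. Let $\mu_V$ be the equilibrium measure of $V$, i.e. the minimizer over all probability measures $\mu$ on $\mathbb{R}^d$ of $$I_g^V(\mu)=\frac12\iint\bigl\{g(x,y)+V(x)+V(y)\bigr\}\,d\mu(x)\,d\mu(y),$$ and assume that $\mu_V$ has finite entropy, i.e. it has a Lebesgue density $\rho$ with $\int |\log\rho|\,d\mu_V<\infty$. Let $u>0$, $\delta>0$, and let $\beta_n\ge u\,n^{1+\delta}$ for all $n\ge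 2$. For each $n\ge2$ let $(x_1,\dots,x_n)=(x_1^{(n)},\dots,x_n^{(n)})$ be distributed according to the Coulomb gas $$d\mathbb{P}_{n,\beta_n}^V(x_1,\dots,x_n)=\frac1{Z_{n,\beta_n}^V}\exp\Bigl(-\beta_n\Bigl[\frac1{2n^2}\sum_{i\ne j}g(x_i,x_j)+\frac1n\sum_{i=1}^nV(x_i)\Bigr]\Bigr)\,dx_1\cdots dx_n ,$$ where it is assumed that $Z_{n,\beta_n}^V<\infty$ for all $n\ge2$ (which holds for instance if $\beta_n\ge c'n$). All these random vectors are defined on one probability space $(\Omega,\mathcal F,\mathbb P)$, with an arbitrary joint law. Let $\mu_n=\frac1n\sum_{i=1}^n\delta_{x_i}$ and let $$0<\zeta<\frac{\min\bigl(\delta,\tfrac{2}{d+2}\bigr)}{d-2}.$$ Then $U_g^{\mu_V}$ is finite everywhere on $\mathbb{R}^d$ and, $\mathbb P$-almost surely, $$\sup_{z\in\mathbb{R}^d}\bigl|U_{K_\zeta}^{\mu_n}(z)-U_g^{\mu_V}(z)\bigr|\longrightarrow 0\qquad(n\to\infty).$$ -/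

import Mathlib

open MeasureTheory ProbabilityTheory Filter Topology
open scoped ENNReal

noncomputable section

namespace CoulombGas

variable {d : ℕ}

/-- The Coulomb kernel `g(x, y) = 1 / |x - y| ^ (d - 2)` (for `d ≥ 3`), equal to `∞` on the
diagonal. -/
def coulombKernel (x y : EuclideanSpace ℝ (Fin d)) : ℝ≥0∞ :=
  (edist x y ^ (d - 2))⁻¹

/-- The regularized Coulomb kernel `K_ζ(x, y) = 1 / (|x - y|² + n^{-2ζ}) ^ ((d - 2) / 2)`. -/
def regularizedKernel (n : ℕ) (ζ : ℝ) (x y : EuclideanSpace ℝ (Fin d)) : ℝ≥0∞ :=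
  ENNReal.ofReal (1 / (‖x - y‖ ^ 2 + (n : ℝ) ^ (-2 * ζ)) ^ (((d : ℝ) - 2) / 2))

/-- The potential `U_K^μ(z) = ∫ K(z, x) dμ(x)` of a measure, for a kernel with values in
`[0, ∞]`. -/
def potential (K : EuclideanSpace ℝ (Fin d) → EuclideanSpace ℝ (Fin d) → ℝ≥0∞)
    (μ : Measure (EuclideanSpace ℝ (Fin d))) (z : EuclideanSpace ℝ (Fin d)) : ℝ≥0∞ :=
  ∫⁻ x, K z x ∂μ

/-- The Coulomb energy `I_g^V(μ) = ½ ∬ (g(x, y) + V(x) + V(y)) dμ(x) dμ(y)` in the external field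
`V ≥ 0`, with values in `[0, ∞]`. -/
def energy (V : EuclideanSpace ℝ (Fin d) → ℝ) (μ : Measure (EuclideanSpace ℝ (Fin d))) : ℝ≥0∞ :=
  2⁻¹ * ∫⁻ x, ∫⁻ y, (coulombKernel x y + ENNReal.ofReal (V x) + ENNReal.ofReal (V y)) ∂μ ∂μ

/-- `V` is a confinement: continuous, nonnegative, tending to `+∞` at infinity, and
`exp (-c' V)` is Lebesgue integrable for some `c' > 0`. -/
structure IsConfinement (V : EuclideanSpace ℝ (Fin d) → ℝ) : Prop where
  continuous : Continuous V
  nonneg : ∀ x, 0 ≤ V x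
  tendsto : Tendsto V (cocompact (EuclideanSpace ℝ (Fin d))) atTop
  integrable_exp : ∃ c' : ℝ, 0 < c' ∧ Integrable (fun x => Real.exp (-c' * V x))

/-- `μ` is the equilibrium measure of `V`: a probability measure that minimizes the energy
`I_g^V` over all probability measures. -/
structure IsEquilibriumMeasure (V : EuclideanSpace ℝ (Fin d) → ℝ)
    (μ : Measure (EuclideanSpace ℝ (Fin d))) : Prop where
  isProbabilityMeasure : IsProbabilityMeasure μ
  energy_le : ∀ ν : Measure (EuclideanSpace ℝ (Fin d)), IsProbabilityMeasure ν →
    energy V μ ≤ energy V ν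

/-- `μ` has a density `ρ` with respect to Lebesgue measure, and its entropy `∫ ρ log ρ` is
finite. -/
structure HasFiniteEntropy (μ : Measure (EuclideanSpace ℝ (Fin d))) : Prop where
  absolutelyContinuous : μ ≪ volume
  integrable_log : Integrable (fun x => Real.log (μ.rnDeriv volume x).toReal) μ

/-- The discrete energy
`H_n(x_1, …, x_n) = 1 / (2 n²) ∑_{i ≠ j} g(x_i, x_j) + 1 / n ∑_i V(x_i)`. At configurations with
coinciding points, which form a Lebesgue null set, the infinite terms are replaced by `0`. -/
def discreteEnergy (V : EuclideanSpace ℝ (Fin d) → ℝ) (n : ℕ)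
    (x : Fin n → EuclideanSpace ℝ (Fin d)) : ℝ :=
  1 / (2 * (n : ℝ) ^ 2) *
      (∑ i : Fin n, ∑ j : Fin n, if i ≠ j then (coulombKernel (x i) (x j)).toReal else 0) +
    1 / (n : ℝ) * ∑ i : Fin n, V (x i)

/-- The unnormalized Boltzmann weight `exp (-β H_n)`. -/
def boltzmannWeight (V : EuclideanSpace ℝ (Fin d) → ℝ) (n : ℕ) (β : ℝ)
    (x : Fin n → EuclideanSpace ℝ (Fin d)) : ℝ≥0∞ :=
  ENNReal.ofReal (Real.exp (-β * discreteEnergy V n x))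

/-- The partition function `Z = ∫ exp (-β H_n(x)) dx_1 ⋯ dx_n`. -/
def partitionFunction (V : EuclideanSpace ℝ (Fin d) → ℝ) (n : ℕ) (β : ℝ) : ℝ≥0∞ :=
  ∫⁻ x : Fin n → EuclideanSpace ℝ (Fin d), boltzmannWeight V n β x

/-- The Coulomb gas: the Gibbs measure `Z⁻¹ exp (-β H_n(x)) dx_1 ⋯ dx_n`. It is a probability
measure when `0 < Z < ∞` (and the zero measure when `Z = ∞`). -/
def gibbsMeasure (V : EuclideanSpace ℝ (Fin d) → ℝ) (n : ℕ) (β : ℝ) :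
    Measure (Fin n → EuclideanSpace ℝ (Fin d)) :=
  (partitionFunction V n β)⁻¹ • (volume.withDensity (boltzmannWeight V n β))

/-- The empirical measure `1 / n ∑_i δ_{x_i}`. -/
def empiricalMeasure {n : ℕ} (x : Fin n → EuclideanSpace ℝ (Fin d)) :
    Measure (EuclideanSpace ℝ (Fin d)) :=
  (n : ℝ≥0∞)⁻¹ • ∑ i : Fin n, Measure.dirac (x i)

end CoulombGas

end

/-! For `d ≥ 3` the Coulomb kernel is, up to the factor `greenConstant`, the superposition of the
heat kernels `p_t` over all `t > 0`, and the regularized kernel is the same superposition with the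
extra weight `exp (-q / (4 t))`, where `q = n^{-2ζ}`. So every kernel is some `mixtureKernel w` and
can be studied one time at a time: positive definiteness comes from the semigroup property,
regularization damps small times, and smoothing by `p_s` shifts times by `s`. Inequalities between
signed quantities are rearranged into sums of terms in `[0, ∞]`.

Deterministic part. Minimality of `μ` gives the Euler-Lagrange conditions: `U + V ≥ C`
Lebesgue-a.e., with equality `μ`-a.e. Averaging against `p_s`, with the second derivative of `V`
bounded, yields at every point `C ≤ U_s + V + O(s)`, where `U_s` keeps only the times beyond `s`.
Integrating this against the empirical measure `μ_n` gives `⟨μ_n - μ, μ_n - μ⟩_s ≤ 2 (H_n - I(μ)) +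
O(s^{-(d-2)/2} / n) + O(s)`, the middle term being the self-interaction of the atoms. Positive
definiteness tested against a point mass `c δ_z` converts this into a bound on the difference of
potentials, uniform in `z` (`abs_potential_longTime_sub_le`). The Euler-Lagrange conditions also
make the short-time part of the potential of `μ` small on a closed set carrying `μ`. The same
comparison with that set (`potential_le_of_forall_mem`) shows that the regularized potentials of `μ`
converge uniformly to its Coulomb potential (`potential_coscreening_le`).

Probabilistic part. Jensen's inequality with the trial law `μ^{⊗n}` bounds the partition function
below; finite entropy enters here. Hence `H_n ≥ I(μ) + η` has probability at most `exp (A n - (β_n -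
θ n) η)`. For `η = n^{-b}` with `b < δ` this is summable, and Borel-Cantelli applies whatever the
joint law. With `s = n^{-2a}` and `c = τ n^{-ζ(d-2)}` the errors vanish, up to `τ / 2`, because
`ζ(d-2)` is smaller than `b`, `1 - a(d-2)` and `2a`. -/

noncomputable section

namespace CoulombGas

variable {d : ℕ}

/-! ### Gaussian heat kernels and the semigroup property. -/

/-- The Euclidean space `ℝ^d`. -/
abbrev Space (d : ℕ) : Type := EuclideanSpace ℝ (Fin d)

/-- The heat kernel of `ℝ^d` at time `t`, as a function of the squared distance `R`. -/
def heatProfile (d : ℕ) (t R : ℝ) : ℝ :=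
  (4 * Real.pi * t) ^ (-((d : ℝ) / 2)) * Real.exp (-(R / (4 * t)))

/-- The heat kernel of `ℝ^d`. -/
def heatKernel (t : ℝ) (x y : Space d) : ℝ≥0∞ :=
  ENNReal.ofReal (heatProfile d t (‖x - y‖ ^ 2))

theorem heatProfile_nonneg {t : ℝ} (ht : 0 < t) (R : ℝ) : 0 ≤ heatProfile d t R := by
  unfold heatProfile; positivity

theorem measurable_heatProfile (d : ℕ) : Measurable fun p : ℝ × ℝ => heatProfile d p.1 p.2 := by
  unfold heatProfile; fun_prop

@[fun_prop]
theorem measurable_heatProfile_comp {α : Type*} [MeasurableSpace α] {f g : α → ℝ}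
    (hf : Measurable f) (hg : Measurable g) :
    Measurable fun a => heatProfile d (f a) (g a) :=
  (measurable_heatProfile d).comp (hf.prodMk hg)

@[fun_prop]
theorem measurable_heatKernel_comp {α : Type*} [MeasurableSpace α] {t : α → ℝ} {f g : α → Space d}
    (ht : Measurable t) (hf : Measurable f) (hg : Measurable g) :
    Measurable fun a => heatKernel (t a) (f a) (g a) := by
  unfold heatKernel; fun_prop

theorem heatKernel_comm (t : ℝ) (x y : Space d) : heatKernel t x y = heatKernel t y x := by
  simp only [heatKernel, norm_sub_rev]

theorem heatProfile_anti {t : ℝ} (ht : 0 < t) {R R' : ℝ} (h : R ≤ R') :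
    heatProfile d t R' ≤ heatProfile d t R := by
  unfold heatProfile; gcongr

theorem heatKernel_le_self {t : ℝ} (ht : 0 < t) (x y z : Space d) :
    heatKernel t x y ≤ heatKernel t z z := by
  refine ENNReal.ofReal_le_ofReal (heatProfile_anti ht ?_)
  simp

theorem lintegral_heatKernel {t : ℝ} (ht : 0 < t) (x : Space d) :
    ∫⁻ y, heatKernel t x y = 1 := by
  have h1 : ∫⁻ y, heatKernel t x y
      = ∫⁻ y : Space d, ENNReal.ofReal (heatProfile d t (‖y‖ ^ 2)) := by
    simp only [heatKernel]
    exact lintegral_sub_left_eq_self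
      (fun y : Space d => ENNReal.ofReal (heatProfile d t (‖y‖ ^ 2))) x
  have h2 := GaussianFourier.integral_rexp_neg_mul_sq_norm (V := Space d)
    (b := 1 / (4 * t)) (by positivity)
  have h3 : ∀ y : Space d, heatProfile d t (‖y‖ ^ 2)
      = (4 * Real.pi * t) ^ (-((d : ℝ) / 2)) * Real.exp (-(1 / (4 * t)) * ‖y‖ ^ 2) := by
    intro y; unfold heatProfile; congr 2; ring
  have h4 : ∫ y : Space d, heatProfile d t (‖y‖ ^ 2) = 1 := by
    simp only [h3]
    rw [integral_const_mul, h2, Real.rpow_neg (by positivity)]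
    have : Real.pi / (1 / (4 * t)) = 4 * Real.pi * t := by field_simp
    rw [this, finrank_euclideanSpace_fin]
    exact inv_mul_cancel₀ (by positivity)
  rw [h1, ← ofReal_integral_eq_lintegral_ofReal, h4, ENNReal.ofReal_one]
  · by_contra h
    rw [integral_undef h] at h4; norm_num at h4
  · exact Eventually.of_forall fun y => heatProfile_nonneg ht _

/-- Completing the square in `w`: a product of Gaussians centred at `x` and `y` is a Gaussian
centred at a weighted mean, times a factor free of `w`. -/
theorem norm_combination_sq {s t : ℝ} (hs : 0 < s) (ht : 0 < t) (x y w : Space d) :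
    ‖x - w‖ ^ 2 / (4 * s) + ‖w - y‖ ^ 2 / (4 * t)
      = ‖x - y‖ ^ 2 / (4 * (s + t))
        + ‖((t / (s + t)) • x + (s / (s + t)) • y) - w‖ ^ 2 / (4 * (s * t / (s + t))) := by
  have e1 : ((t / (s + t)) • x + (s / (s + t)) • y) - w
      = (t / (s + t)) • (x - w) - (s / (s + t)) • (w - y) := by
    have : w = (t / (s + t)) • w + (s / (s + t)) • w := by
      rw [← add_smul, ← add_div, add_comm t s, div_self (by positivity), one_smul]
    nth_rewrite 1 [this]
    simp only [smul_sub]; abel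
  have e2 : x - y = (x - w) + (w - y) := by abel
  rw [e1, e2]
  generalize x - w = a, w - y = b
  rw [@norm_add_sq_real, @norm_sub_sq_real, norm_smul, norm_smul, inner_smul_left,
    inner_smul_right]
  simp only [Real.norm_eq_abs, mul_pow, sq_abs, conj_trivial]
  field_simp
  ring

theorem heatProfile_mul {s t : ℝ} (hs : 0 < s) (ht : 0 < t) (x y w : Space d) :
    heatProfile d s (‖x - w‖ ^ 2) * heatProfile d t (‖w - y‖ ^ 2)
      = heatProfile d (s + t) (‖x - y‖ ^ 2) * heatProfile d (s * t / (s + t))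
        (‖((t / (s + t)) • x + (s / (s + t)) • y) - w‖ ^ 2) := by
  unfold heatProfile
  have h := norm_combination_sq hs ht x y w
  have hc : (4 * Real.pi * s) ^ (-((d : ℝ) / 2)) * (4 * Real.pi * t) ^ (-((d : ℝ) / 2))
      = (4 * Real.pi * (s + t)) ^ (-((d : ℝ) / 2)) *
        (4 * Real.pi * (s * t / (s + t))) ^ (-((d : ℝ) / 2)) := by
    rw [← Real.mul_rpow (by positivity) (by positivity),
      ← Real.mul_rpow (by positivity) (by positivity)]
    congr 1; field_simp
  rw [mul_mul_mul_comm, hc, mul_mul_mul_comm (_ ^ _) (Real.exp _), ← Real.exp_add, ← Real.exp_add,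
    ← neg_add, ← neg_add, h]

/-- The semigroup property of the heat kernel. -/
theorem lintegral_heatKernel_mul {s t : ℝ} (hs : 0 < s) (ht : 0 < t) (x y : Space d) :
    ∫⁻ w, heatKernel s x w * heatKernel t w y = heatKernel (s + t) x y := by
  have h : ∀ w, heatKernel s x w * heatKernel t w y = heatKernel (s + t) x y *
      heatKernel (s * t / (s + t)) ((t / (s + t)) • x + (s / (s + t)) • y) w := by
    intro w
    simp only [heatKernel]
    rw [← ENNReal.ofReal_mul (heatProfile_nonneg hs _),
      ← ENNReal.ofReal_mul (heatProfile_nonneg (by positivity) _), heatProfile_mul hs ht]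
  simp only [h]
  rw [lintegral_const_mul _ (by fun_prop), lintegral_heatKernel (by positivity), mul_one]

/-! ### Parabolic scaling and the integral over all times. -/

theorem lintegral_Ioi_eq_mul {a : ℝ} (ha : 0 < a) (f : ℝ → ℝ≥0∞) :
    ∫⁻ t in Set.Ioi 0, f t = ENNReal.ofReal a * ∫⁻ t in Set.Ioi 0, f (a * t) := by
  have h1 := Real.smul_map_volume_mul_left ha.ne'
  have h2 : ∫⁻ t, (Set.Ioi 0).indicator f t ∂(volume : Measure ℝ)
      = ENNReal.ofReal a * ∫⁻ t, (Set.Ioi 0).indicator f (a * t) := by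
    conv_lhs => rw [← h1]
    rw [lintegral_smul_measure, abs_of_pos ha, smul_eq_mul,
      show (fun x : ℝ => a * x) = (Homeomorph.mulLeft₀ a ha.ne').toMeasurableEquiv from rfl,
      lintegral_map_equiv]
    rfl
  rw [← lintegral_indicator measurableSet_Ioi, ← lintegral_indicator measurableSet_Ioi, h2]
  congr 2; ext t
  by_cases ht : 0 < t
  · simp [Set.indicator, ht, ha]
  · simp [Set.indicator, ht, ha]

/-- The integral over all times of the heat kernel at distance one. -/
def greenConstant (d : ℕ) : ℝ≥0∞ := ∫⁻ t in Set.Ioi 0, ENNReal.ofReal (heatProfile d t 1)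

theorem heatProfile_scale {a t R : ℝ} (ha : 0 < a) (ht : 0 < t) :
    heatProfile d (a * t) (a * R) = a ^ (-((d : ℝ) / 2)) * heatProfile d t R := by
  unfold heatProfile
  rw [show 4 * Real.pi * (a * t) = a * (4 * Real.pi * t) by ring,
    Real.mul_rpow ha.le (by positivity), mul_assoc]
  congr 4
  field_simp

/-- The substitution `t ↦ R t` reduces to distance one; the Jacobian `R` and the scaling factor
`R^{-d/2}` combine to `R^{-(d-2)/2}`. -/
theorem lintegral_heatProfile {R : ℝ} (hR : 0 < R) :
    ∫⁻ t in Set.Ioi 0, ENNReal.ofReal (heatProfile d t R)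
      = ENNReal.ofReal (1 / R ^ (((d : ℝ) - 2) / 2)) * greenConstant d := by
  rw [lintegral_Ioi_eq_mul hR, greenConstant, ← lintegral_const_mul _ (by fun_prop),
    ← lintegral_const_mul _ (by fun_prop)]
  refine setLIntegral_congr_fun measurableSet_Ioi fun t ht => ?_
  have ht : 0 < t := ht
  have h := heatProfile_scale (d := d) (R := 1) hR ht
  rw [mul_one] at h
  rw [h, ← ENNReal.ofReal_mul hR.le, ← ENNReal.ofReal_mul (by positivity), ← mul_assoc]
  congr 2
  rw [one_div, ← Real.rpow_neg hR.le]
  nth_rewrite 1 [← Real.rpow_one R]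
  rw [← Real.rpow_add hR]; congr 1; ring

theorem greenConstant_pos (d : ℕ) : greenConstant d ≠ 0 := by
  unfold greenConstant
  rw [Ne, lintegral_eq_zero_iff (by fun_prop)]
  intro h
  have h' : ∀ᵐ t : ℝ ∂volume.restrict (Set.Ioi 0), False := by
    filter_upwards [h, ae_restrict_mem measurableSet_Ioi] with t h1 h2
    have h2 : 0 < t := h2
    have : 0 < heatProfile d t 1 := by unfold heatProfile; positivity
    simp only [Pi.zero_apply, ENNReal.ofReal_eq_zero] at h1
    linarith
  rw [Filter.eventually_false_iff_eq_bot, ae_eq_bot] at h'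
  have := congrArg (fun μ => μ Set.univ) h'
  simp at this

/-- Near `0` the Gaussian factor beats every power of `t`; at infinity `t^{-d/2}` is integrable
because `d ≥ 3`. -/
theorem greenConstant_ne_top (hd : 3 ≤ d) : greenConstant d ≠ ∞ := by
  have hd' : (3 : ℝ) ≤ d := by exact_mod_cast hd
  unfold greenConstant
  have hsplit : Set.Ioi (0 : ℝ) = Set.Ioc 0 1 ∪ Set.Ioi 1 :=
    (Set.Ioc_union_Ioi_eq_Ioi zero_le_one).symm
  rw [hsplit]
  refine ne_top_of_le_ne_top ?_ (lintegral_union_le _ _ _)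
  refine ENNReal.add_ne_top.2 ⟨?_, ?_⟩
  · obtain ⟨N, hN⟩ := exists_nat_ge ((d : ℝ) / 2)
    have hb : ∀ t ∈ Set.Ioc (0 : ℝ) 1, heatProfile d t 1 ≤ 4 ^ N * N.factorial := by
      intro t ht
      have h0 : 0 < t := ht.1
      have hp : 1 ≤ Real.pi := by linarith [Real.pi_gt_three]
      have h1 : (4 * Real.pi * t) ^ (-((d : ℝ) / 2)) ≤ t ^ (-((d : ℝ) / 2)) :=
        Real.rpow_le_rpow_of_nonpos h0 (by nlinarith) (by linarith)
      have h2 : t ^ (-((d : ℝ) / 2)) ≤ t ^ (-(N : ℝ)) :=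
        Real.rpow_le_rpow_of_exponent_ge h0 ht.2 (by linarith)
      have h3 := Real.pow_div_factorial_le_exp (1 / (4 * t)) (by positivity) N
      have h4 : t ^ (-(N : ℝ)) = (4 : ℝ) ^ N * N.factorial * ((1 / (4 * t)) ^ N / N.factorial) := by
        rw [Real.rpow_neg h0.le, Real.rpow_natCast]
        have : (N.factorial : ℝ) ≠ 0 := by positivity
        rw [one_div, inv_pow, mul_pow]
        field_simp
      unfold heatProfile
      rw [Real.exp_neg]
      calc _ ≤ (4 : ℝ) ^ N * N.factorial * Real.exp (1 / (4 * t)) * (Real.exp (1 / (4 * t)))⁻¹ := by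
            gcongr
            calc _ ≤ _ := h1.trans h2
              _ ≤ _ := by rw [h4]; gcongr
        _ = _ := by field_simp
    refine ne_top_of_le_ne_top ?_ (setLIntegral_mono' measurableSet_Ioc
      fun t ht => ENNReal.ofReal_le_ofReal (hb t ht))
    simp [ENNReal.mul_eq_top]
  · have hi := integrableOn_Ioi_rpow_of_lt (a := -((d : ℝ) / 2)) (c := 1) (by linarith) one_pos
    refine ne_top_of_le_ne_top hi.lintegral_lt_top.ne (setLIntegral_mono' measurableSet_Ioi
      fun t ht => ENNReal.ofReal_le_ofReal ?_)
    have h0 : 0 < t := lt_trans one_pos ht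
    have hp : 1 ≤ Real.pi := by linarith [Real.pi_gt_three]
    unfold heatProfile
    have h1 : (4 * Real.pi * t) ^ (-((d : ℝ) / 2)) ≤ t ^ (-((d : ℝ) / 2)) :=
      Real.rpow_le_rpow_of_nonpos h0 (by nlinarith) (by linarith)
    have h2 : Real.exp (-(1 / (4 * t))) ≤ 1 := by
      rw [Real.exp_le_one_iff, Left.neg_nonpos_iff]; positivity
    exact (mul_le_of_le_one_right (by positivity) h2).trans h1

/-! ### Coulomb and regularized kernels as mixtures of heat kernels. -/

/-- The measure on positive times for which the Coulomb kernel is the integral of the heat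
kernels. -/
def timeMeasure (d : ℕ) : Measure ℝ := (greenConstant d)⁻¹ • volume.restrict (Set.Ioi 0)

instance : SFinite (timeMeasure d) := by unfold timeMeasure; infer_instance

theorem ae_timeMeasure_pos (d : ℕ) : ∀ᵐ t ∂timeMeasure d, 0 < t :=
  Measure.ae_smul_measure (ae_restrict_mem measurableSet_Ioi) _

theorem lintegral_timeMeasure (f : ℝ → ℝ≥0∞) :
    ∫⁻ t, f t ∂timeMeasure d = (greenConstant d)⁻¹ * ∫⁻ t in Set.Ioi 0, f t := by
  rw [timeMeasure, lintegral_smul_measure, smul_eq_mul]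

theorem lintegral_timeMeasure_eq_mul {a : ℝ} (ha : 0 < a) (f : ℝ → ℝ≥0∞) :
    ∫⁻ t, f t ∂timeMeasure d = ENNReal.ofReal a * ∫⁻ t, f (a * t) ∂timeMeasure d := by
  rw [lintegral_timeMeasure, lintegral_timeMeasure, lintegral_Ioi_eq_mul ha]; ring

theorem lintegral_timeMeasure_add {s : ℝ} (hs : 0 ≤ s) (f : ℝ → ℝ≥0∞) :
    ∫⁻ t, f (t + s) ∂timeMeasure d = ∫⁻ t in Set.Ioi s, f t ∂timeMeasure d := by
  rw [timeMeasure, Measure.restrict_smul, lintegral_smul_measure, lintegral_smul_measure,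
    Measure.restrict_restrict measurableSet_Ioi, Set.Ioi_inter_Ioi, sup_of_le_left hs,
    ← lintegral_indicator measurableSet_Ioi, ← lintegral_indicator measurableSet_Ioi]
  congr 1
  rw [← lintegral_add_right_eq_self ((Set.Ioi s).indicator f) s]
  congr 1; ext t
  by_cases ht : 0 < t
  · simp [Set.indicator, ht]
  · simp [Set.indicator, ht]

/-- The superposition `∫ w(t) p_t(x, y) dt` of heat kernels. -/
def mixtureKernel (w : ℝ → ℝ≥0∞) (x y : Space d) : ℝ≥0∞ :=
  ∫⁻ t, w t * heatKernel t x y ∂timeMeasure d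

/-- The weight `exp (-q / (4 t))`. -/
def screening (q t : ℝ) : ℝ≥0∞ := ENNReal.ofReal (Real.exp (-(q / (4 * t))))

@[fun_prop]
theorem measurable_screening (q : ℝ) : Measurable (screening q) := by
  unfold screening; fun_prop

@[fun_prop]
theorem measurable_mixtureKernel_comp {α : Type*} [MeasurableSpace α] {w : ℝ → ℝ≥0∞}
    {f g : α → Space d}
    (hw : Measurable w) (hf : Measurable f) (hg : Measurable g) :
    Measurable fun a => mixtureKernel w (f a) (g a) := by
  unfold mixtureKernel
  refine Measurable.lintegral_prod_right'
    (f := fun p : α × ℝ => w p.2 * heatKernel p.2 (f p.1) (g p.1)) ?_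
  fun_prop

theorem mixtureKernel_mono {v w : ℝ → ℝ≥0∞} (h : ∀ t, 0 < t → v t ≤ w t) (x y : Space d) :
    mixtureKernel v x y ≤ mixtureKernel w x y := by
  refine lintegral_mono_ae ?_
  filter_upwards [ae_timeMeasure_pos d] with t ht
  gcongr; exact h t ht

theorem mixtureKernel_le_self (w : ℝ → ℝ≥0∞) (x y z : Space d) :
    mixtureKernel w x y ≤ mixtureKernel w z z := by
  refine lintegral_mono_ae ?_
  filter_upwards [ae_timeMeasure_pos d] with t ht
  gcongr; exact heatKernel_le_self ht x y z

theorem mixtureKernel_add {v w : ℝ → ℝ≥0∞} (hv : Measurable v) (x y : Space d) :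
    mixtureKernel (fun t => v t + w t) x y = mixtureKernel v x y + mixtureKernel w x y := by
  simp only [mixtureKernel, add_mul]
  rw [lintegral_add_left (by fun_prop)]

theorem mixtureKernel_const_mul {w : ℝ → ℝ≥0∞} (hw : Measurable w) (c : ℝ≥0∞) (x y : Space d) :
    mixtureKernel (fun t => c * w t) x y = c * mixtureKernel w x y := by
  simp only [mixtureKernel, mul_assoc]
  rw [lintegral_const_mul _ (by fun_prop)]

/-- The weight merely adds `q` to the squared distance in the Gaussian exponent. -/
theorem mixtureKernel_screening (hd : 3 ≤ d) {q : ℝ} (hq : 0 < q) (x y : Space d) :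
    mixtureKernel (screening q) x y
      = ENNReal.ofReal (1 / (‖x - y‖ ^ 2 + q) ^ (((d : ℝ) - 2) / 2)) := by
  unfold mixtureKernel
  rw [lintegral_timeMeasure]
  have h : ∀ t : ℝ, screening q t * heatKernel t x y
      = ENNReal.ofReal (heatProfile d t (‖x - y‖ ^ 2 + q)) := by
    intro t
    rw [screening, heatKernel, ← ENNReal.ofReal_mul (Real.exp_nonneg _)]
    unfold heatProfile
    rw [mul_left_comm, ← Real.exp_add]
    congr 3; ring
  simp only [h]
  rw [lintegral_heatProfile (by positivity), mul_left_comm,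
    ENNReal.inv_mul_cancel (greenConstant_pos d) (greenConstant_ne_top hd), mul_one]

theorem coulombKernel_eq_ofReal (hd : 3 ≤ d) {x y : Space d} (hxy : x ≠ y) :
    coulombKernel x y = ENNReal.ofReal (1 / (‖x - y‖ ^ 2) ^ (((d : ℝ) - 2) / 2)) := by
  have h0 : 0 < ‖x - y‖ := norm_pos_iff.2 (sub_ne_zero.2 hxy)
  rw [coulombKernel, edist_dist, dist_eq_norm, ← ENNReal.ofReal_pow h0.le,
    ← ENNReal.ofReal_inv_of_pos (by positivity), one_div]
  congr 2
  rw [← Real.rpow_natCast, ← Real.rpow_natCast, ← Real.rpow_mul h0.le, Nat.cast_sub (by omega)]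
  congr 1; push_cast; ring

theorem mixtureKernel_one (hd : 3 ≤ d) (x y : Space d) :
    mixtureKernel 1 x y = coulombKernel x y := by
  have hd' : (3 : ℝ) ≤ d := by exact_mod_cast hd
  by_cases hxy : x = y
  · subst hxy
    have h1 : coulombKernel x x = ∞ := by
      simp [coulombKernel, show d - 2 ≠ 0 by omega]
    rw [h1]
    refine ENNReal.eq_top_of_forall_nnreal_le fun r => le_of_lt ?_
    -- Chosen so that the screened kernel with parameter `R`, a lower bound for the mixture, equals
    -- `r + 1` on the diagonal.
    set R : ℝ := ((r : ℝ) + 1) ^ (-(2 / ((d : ℝ) - 2))) with hR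
    have hR0 : 0 < R := by positivity
    have h2 : mixtureKernel (screening R) x x ≤ mixtureKernel 1 x x := by
      refine mixtureKernel_mono (fun t ht => ?_) x x
      rw [screening, Pi.one_apply, ENNReal.ofReal_le_one, Real.exp_le_one_iff, Left.neg_nonpos_iff]
      positivity
    refine lt_of_lt_of_le ?_ h2
    rw [mixtureKernel_screening hd hR0]
    have h3 : 1 / (‖x - x‖ ^ 2 + R) ^ (((d : ℝ) - 2) / 2) = r + 1 := by
      rw [sub_self, norm_zero, zero_pow two_ne_zero, zero_add, hR, ← Real.rpow_mul (by positivity)]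
      have : -(2 / ((d : ℝ) - 2)) * (((d : ℝ) - 2) / 2) = -1 := by
        have : (d : ℝ) - 2 ≠ 0 := by linarith
        field_simp
      rw [this, Real.rpow_neg_one, one_div, inv_inv]
    rw [h3, ENNReal.lt_ofReal_iff_toReal_lt ENNReal.coe_ne_top, ENNReal.coe_toReal]
    linarith
  · have h0 : 0 < ‖x - y‖ := norm_pos_iff.2 (sub_ne_zero.2 hxy)
    rw [coulombKernel_eq_ofReal hd hxy]
    unfold mixtureKernel
    simp only [Pi.one_apply, one_mul, heatKernel]
    rw [lintegral_timeMeasure, lintegral_heatProfile (by positivity), mul_left_comm,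
      ENNReal.inv_mul_cancel (greenConstant_pos d) (greenConstant_ne_top hd), mul_one]

theorem regularizedKernel_eq (hd : 3 ≤ d) {n : ℕ} (hn : n ≠ 0) (ζ : ℝ) (x y : Space d) :
    regularizedKernel n ζ x y = mixtureKernel (screening ((n : ℝ) ^ (-2 * ζ))) x y := by
  rw [mixtureKernel_screening hd (by positivity)]; rfl

/-! ### Interactions, positive definiteness and duality. -/

/-- The interaction `∬ K(x, y) dα(x) dβ(y)`. -/
def interaction (K : Space d → Space d → ℝ≥0∞) (α β : Measure (Space d)) : ℝ≥0∞ :=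
  ∫⁻ x, potential K β x ∂α

@[fun_prop]
theorem measurable_potential_heatKernel_comp {α : Type*} [MeasurableSpace α] {t : α → ℝ}
    {f : α → Space d}
    (μ : Measure (Space d)) [SFinite μ] (ht : Measurable t) (hf : Measurable f) :
    Measurable fun a => potential (heatKernel (t a)) μ (f a) := by
  unfold potential
  refine Measurable.lintegral_prod_right'
    (f := fun p : α × Space d => heatKernel (t p.1) (f p.1) p.2) ?_
  fun_prop

@[fun_prop]
theorem measurable_interaction_heatKernel_comp {α : Type*} [MeasurableSpace α] {t : α → ℝ}
    (μ ν : Measure (Space d)) [SFinite μ] [SFinite ν] (ht : Measurable t) :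
    Measurable fun a => interaction (heatKernel (t a)) μ ν := by
  unfold interaction
  refine Measurable.lintegral_prod_right'
    (f := fun p : α × Space d => potential (heatKernel (t p.1)) ν p.2) ?_
  fun_prop

theorem potential_mixtureKernel {w : ℝ → ℝ≥0∞} (hw : Measurable w) (μ : Measure (Space d))
    [SFinite μ] (z : Space d) :
    potential (mixtureKernel w) μ z
      = ∫⁻ t, w t * potential (heatKernel t) μ z ∂timeMeasure d := by
  simp only [potential, mixtureKernel]
  rw [lintegral_lintegral_swap (by fun_prop)]
  refine lintegral_congr fun t => ?_
  rw [lintegral_const_mul _ (by fun_prop)]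

theorem interaction_mixtureKernel {w : ℝ → ℝ≥0∞} (hw : Measurable w) (α β : Measure (Space d))
    [SFinite α] [SFinite β] :
    interaction (mixtureKernel w) α β
      = ∫⁻ t, w t * interaction (heatKernel t) α β ∂timeMeasure d := by
  simp only [interaction, potential_mixtureKernel hw]
  rw [lintegral_lintegral_swap (by fun_prop)]
  refine lintegral_congr fun t => ?_
  rw [lintegral_const_mul _ (by fun_prop)]

theorem interaction_heatKernel_comm (t : ℝ) (α β : Measure (Space d)) [SFinite α] [SFinite β] :
    interaction (heatKernel t) α β = interaction (heatKernel t) β α := by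
  simp only [interaction, potential]
  rw [lintegral_lintegral_swap (by fun_prop)]
  simp only [heatKernel_comm t]

/-- Writes the interaction as an `L²` pairing of two smoothed densities, which is the source of
positive definiteness. -/
theorem interaction_heatKernel_add {s t : ℝ} (hs : 0 < s) (ht : 0 < t) (α β : Measure (Space d))
    [SFinite α] [SFinite β] :
    interaction (heatKernel (s + t)) α β
      = ∫⁻ w, potential (heatKernel s) α w * potential (heatKernel t) β w := by
  have h1 : ∀ w, potential (heatKernel s) α w * potential (heatKernel t) β w
      = ∫⁻ x, ∫⁻ y, heatKernel s x w * heatKernel t w y ∂β ∂α := by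
    intro w
    simp only [potential]
    rw [← lintegral_mul_const _ (by fun_prop)]
    refine lintegral_congr fun x => ?_
    rw [← lintegral_const_mul _ (by fun_prop), heatKernel_comm]
  simp only [h1]
  simp only [interaction, potential]
  symm
  rw [lintegral_lintegral_swap]
  · refine lintegral_congr fun x => ?_
    rw [lintegral_lintegral_swap (by fun_prop)]
    exact lintegral_congr fun y => lintegral_heatKernel_mul hs ht x y
  · refine (Measurable.lintegral_prod_right' (f := fun p : (Space d × Space d) × Space d =>
      heatKernel s p.1.2 p.1.1 * heatKernel t p.1.1 p.2) ?_).aemeasurable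
    fun_prop

theorem two_mul_mul_le_sq_add_sq (a b : ℝ≥0∞) : 2 * (a * b) ≤ a * a + b * b := by
  rcases eq_or_ne a ∞ with rfl | ha
  · simp
  rcases eq_or_ne b ∞ with rfl | hb
  · simp
  lift a to NNReal using ha
  lift b to NNReal using hb
  norm_cast
  rw [← NNReal.coe_le_coe]; push_cast
  nlinarith [sq_nonneg ((a : ℝ) - b)]

/-- The heat kernel is positive definite. -/
theorem two_mul_interaction_heatKernel_le {t : ℝ} (ht : 0 < t) (α β : Measure (Space d))
    [SFinite α] [SFinite β] :
    2 * interaction (heatKernel t) α β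
      ≤ interaction (heatKernel t) α α + interaction (heatKernel t) β β := by
  -- Half of the time goes to each measure, which reduces the claim to the pointwise inequality `2 a
  -- b ≤ a² + b²`.
  have ht2 : 0 < t / 2 := by positivity
  have h := fun (α β : Measure (Space d)) (_ : SFinite α) (_ : SFinite β) =>
    interaction_heatKernel_add ht2 ht2 α β
  rw [add_halves] at h
  rw [h α β inferInstance inferInstance, h α α inferInstance inferInstance,
    h β β inferInstance inferInstance, ← lintegral_const_mul _ (by fun_prop),
    ← lintegral_add_left (by fun_prop)]
  exact lintegral_mono fun w => two_mul_mul_le_sq_add_sq _ _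

theorem two_mul_interaction_mixtureKernel_le {w : ℝ → ℝ≥0∞} (hw : Measurable w)
    (α β : Measure (Space d)) [SFinite α] [SFinite β] :
    2 * interaction (mixtureKernel w) α β
      ≤ interaction (mixtureKernel w) α α + interaction (mixtureKernel w) β β := by
  rw [interaction_mixtureKernel hw, interaction_mixtureKernel hw, interaction_mixtureKernel hw,
    ← lintegral_const_mul _ (by fun_prop), ← lintegral_add_left (by fun_prop)]
  refine lintegral_mono_ae ?_
  filter_upwards [ae_timeMeasure_pos d] with t ht
  calc _ = w t * (2 * interaction (heatKernel t) α β) := by ring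
    _ ≤ w t * (interaction (heatKernel t) α α + interaction (heatKernel t) β β) := by
        gcongr; exact two_mul_interaction_heatKernel_le ht α β
    _ = _ := by ring

/-- Nonnegativity of the energy of `α - β - c δ_z`, written without subtraction. Used in both orders
of `α` and `β`, it bounds the difference of their potentials at `z` by their energy distance. -/
theorem two_mul_interaction_heatKernel_add_potential_le {t : ℝ} (ht : 0 < t)
    (α β : Measure (Space d)) [SFinite α] [SFinite β] (z : Space d) (c : ℝ≥0∞) :
    2 * interaction (heatKernel t) α β + 2 * c * potential (heatKernel t) α z
      ≤ interaction (heatKernel t) α α + interaction (heatKernel t) β β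
        + 2 * c * potential (heatKernel t) β z + c ^ 2 * heatKernel t z z := by
  have h := two_mul_interaction_heatKernel_le ht α (β + c • Measure.dirac z)
  have e1 : ∀ x, potential (heatKernel t) (β + c • Measure.dirac z) x
      = potential (heatKernel t) β x + c * heatKernel t x z := by
    intro x
    simp only [potential]
    rw [lintegral_add_measure, lintegral_smul_measure, lintegral_dirac' _ (by fun_prop),
      smul_eq_mul]
  have e2 : ∀ γ : Measure (Space d), ∫⁻ x, heatKernel t x z ∂γ = potential (heatKernel t) γ z :=
    fun γ => lintegral_congr fun x => heatKernel_comm _ _ _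
  have e3 : ∀ (γ : Measure (Space d)),
      interaction (heatKernel t) γ (β + c • Measure.dirac z)
      = interaction (heatKernel t) γ β + c * potential (heatKernel t) γ z := by
    intro γ
    simp only [interaction, e1]
    rw [lintegral_add_right _ (by fun_prop), lintegral_const_mul _ (by fun_prop), e2]
  have e4 : interaction (heatKernel t) (β + c • Measure.dirac z) β
      = interaction (heatKernel t) β β + c * potential (heatKernel t) β z := by
    simp only [interaction]
    rw [lintegral_add_measure, lintegral_smul_measure, lintegral_dirac' _ (by fun_prop),
      smul_eq_mul]
  rw [e3, e3, e4, e1] at h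
  calc _ = 2 * (interaction (heatKernel t) α β + c * potential (heatKernel t) α z) := by ring
    _ ≤ _ := h
    _ = _ := by ring

/-- The duality inequality between potentials and energies. -/
theorem interaction_add_potential_le {v w : ℝ → ℝ≥0∞} (hv : Measurable v) (hw : Measurable w)
    (hvw : ∀ t, v t ≤ w t)
    (α β : Measure (Space d)) [SFinite α] [SFinite β] (z : Space d) (c : ℝ≥0∞) :
    2 * interaction (mixtureKernel w) α β + 2 * c * potential (mixtureKernel v) α z
      ≤ interaction (mixtureKernel w) α α + interaction (mixtureKernel w) β β
        + 2 * c * potential (mixtureKernel v) β z + c ^ 2 * mixtureKernel v z z := by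
  rw [interaction_mixtureKernel hw, interaction_mixtureKernel hw, interaction_mixtureKernel hw,
    potential_mixtureKernel hv, potential_mixtureKernel hv, mixtureKernel,
    ← lintegral_const_mul _ (by fun_prop), ← lintegral_const_mul _ (by fun_prop),
    ← lintegral_const_mul _ (by fun_prop), ← lintegral_const_mul _ (by fun_prop),
    ← lintegral_add_left (by fun_prop), ← lintegral_add_left (by fun_prop),
    ← lintegral_add_left (by fun_prop), ← lintegral_add_left (by fun_prop)]
  refine lintegral_mono_ae ?_
  filter_upwards [ae_timeMeasure_pos d] with t ht
  have h1 := two_mul_interaction_heatKernel_add_potential_le ht α β z c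
  have h2 := two_mul_interaction_heatKernel_le ht α β
  -- Only the part `v` of the weight is tested against the point mass; the rest `r` uses plain
  -- positive definiteness. So the self-interaction at `z` involves `v` alone.
  obtain ⟨r, hr⟩ := exists_add_of_le (hvw t)
  rw [hr]
  calc _ = v t * (2 * interaction (heatKernel t) α β + 2 * c * potential (heatKernel t) α z)
        + r * (2 * interaction (heatKernel t) α β) := by ring
    _ ≤ v t * (interaction (heatKernel t) α α + interaction (heatKernel t) β β
        + 2 * c * potential (heatKernel t) β z + c ^ 2 * heatKernel t z z)
        + r * (interaction (heatKernel t) α α + interaction (heatKernel t) β β) := by gcongr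
    _ = _ := by ring

/-! ### Splitting kernels into short and long times. -/

theorem coulombKernel_eq_mixtureKernel (hd : 3 ≤ d) :
    (coulombKernel : Space d → Space d → ℝ≥0∞) = mixtureKernel 1 := by
  ext x y; exact (mixtureKernel_one hd x y).symm

/-- The indicator of the times larger than `s`. -/
def longTime (s : ℝ) : ℝ → ℝ≥0∞ := (Set.Ioi s).indicator 1

/-- The indicator of the times at most `s`. -/
def shortTime (s : ℝ) : ℝ → ℝ≥0∞ := (Set.Iic s).indicator 1

@[fun_prop]
theorem measurable_longTime (s : ℝ) : Measurable (longTime s) :=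
  measurable_one.indicator measurableSet_Ioi

@[fun_prop]
theorem measurable_shortTime (s : ℝ) : Measurable (shortTime s) :=
  measurable_one.indicator measurableSet_Iic

theorem shortTime_add_longTime (s t : ℝ) : shortTime s t + longTime s t = 1 := by
  by_cases h : t ≤ s
  · simp [shortTime, longTime, Set.indicator, h, not_lt.2 h]
  · simp [shortTime, longTime, Set.indicator, h, not_le.1 h]

theorem longTime_le_one (s t : ℝ) : longTime s t ≤ 1 :=
  (shortTime_add_longTime s t).symm ▸ le_add_self

theorem mixtureKernel_shortTime_add_longTime (s : ℝ) (x y : Space d) :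
    mixtureKernel (shortTime s) x y + mixtureKernel (longTime s) x y = mixtureKernel 1 x y := by
  rw [← mixtureKernel_add (by fun_prop)]
  congr 1; ext t; simp [shortTime_add_longTime]

/-- For `t > s` the weight `exp (-s / (4 t))` is at least `exp (-1/4)`, so the screened kernel with
`q = s`, largest on the diagonal, dominates up to a constant. -/
theorem mixtureKernel_longTime_le (hd : 3 ≤ d) {s : ℝ} (hs : 0 < s) (x y : Space d) :
    mixtureKernel (longTime s) x y
      ≤ ENNReal.ofReal (Real.exp (1 / 4) / s ^ (((d : ℝ) - 2) / 2)) := by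
  refine (mixtureKernel_le_self _ x y 0).trans ?_
  have h : ∀ t, 0 < t → longTime s t ≤ ENNReal.ofReal (Real.exp (1 / 4)) * screening s t := by
    intro t ht
    by_cases h : s < t
    · rw [screening, ← ENNReal.ofReal_mul (by positivity), ← Real.exp_add]
      refine (longTime_le_one s t).trans (ENNReal.one_le_ofReal.2 (Real.one_le_exp ?_))
      have : s / (4 * t) ≤ 1 / 4 := by
        rw [div_le_div_iff₀ (by positivity) (by positivity)]; linarith
      linarith
    · simp [longTime, Set.indicator, h]
  refine (mixtureKernel_mono h 0 0).trans ?_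
  rw [mixtureKernel_const_mul (by fun_prop), mixtureKernel_screening hd hs,
    ← ENNReal.ofReal_mul (by positivity)]
  simp [div_eq_mul_inv]

theorem lintegral_shortTime_ne_top (s : ℝ) : ∫⁻ t, shortTime s t ∂timeMeasure d ≠ ∞ := by
  unfold shortTime
  rw [lintegral_indicator_one measurableSet_Iic, timeMeasure, Measure.smul_apply,
    Measure.restrict_apply measurableSet_Iic, smul_eq_mul]
  refine ENNReal.mul_ne_top (ENNReal.inv_ne_top.2 (greenConstant_pos d)) ?_
  rw [Set.inter_comm, Set.Ioi_inter_Iic]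
  simp

theorem lintegral_mixtureKernel_shortTime (s : ℝ) (x : Space d) :
    ∫⁻ y, mixtureKernel (shortTime s) x y = ∫⁻ t, shortTime s t ∂timeMeasure d := by
  simp only [mixtureKernel]
  rw [lintegral_lintegral_swap (by fun_prop)]
  refine lintegral_congr_ae ?_
  filter_upwards [ae_timeMeasure_pos d] with t ht
  rw [lintegral_const_mul _ (by fun_prop), lintegral_heatKernel ht, mul_one]

@[fun_prop]
theorem measurable_potential_mixtureKernel {w : ℝ → ℝ≥0∞} (hw : Measurable w)
    (μ : Measure (Space d)) [SFinite μ] : Measurable (potential (mixtureKernel w) μ) := by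
  unfold potential
  refine Measurable.lintegral_prod_right'
    (f := fun p : Space d × Space d => mixtureKernel w p.1 p.2) ?_
  fun_prop

theorem interaction_mixtureKernel_comm {w : ℝ → ℝ≥0∞} (hw : Measurable w) (α β : Measure (Space d))
    [SFinite α] [SFinite β] :
    interaction (mixtureKernel w) α β = interaction (mixtureKernel w) β α := by
  rw [interaction_mixtureKernel hw, interaction_mixtureKernel hw]
  simp only [interaction_heatKernel_comm _ α β]

theorem potential_add_smul (K : Space d → Space d → ℝ≥0∞) (p q : ℝ≥0∞) (α β : Measure (Space d))
    (z : Space d) :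
    potential K (p • α + q • β) z = p * potential K α z + q * potential K β z := by
  simp [potential, lintegral_add_measure, lintegral_smul_measure]

/-! ### First variation of the energy and the Euler-Lagrange conditions. -/

theorem interaction_add_smul {w : ℝ → ℝ≥0∞} (hw : Measurable w) (p q : ℝ≥0∞)
    (α β : Measure (Space d)) [SFinite α] [SFinite β] :
    interaction (mixtureKernel w) (p • α + q • β) (p • α + q • β)
      = p ^ 2 * interaction (mixtureKernel w) α α + 2 * p * q * interaction (mixtureKernel w) α β
        + q ^ 2 * interaction (mixtureKernel w) β β := by
  have h : ∀ γ : Measure (Space d), ∫⁻ x, (p * potential (mixtureKernel w) α x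
      + q * potential (mixtureKernel w) β x) ∂γ
      = p * interaction (mixtureKernel w) γ α + q * interaction (mixtureKernel w) γ β := by
    intro γ
    rw [lintegral_add_left (by fun_prop), lintegral_const_mul _ (by fun_prop),
      lintegral_const_mul _ (by fun_prop)]
    rfl
  rw [interaction]
  simp only [potential_add_smul]
  rw [lintegral_add_measure, lintegral_smul_measure, lintegral_smul_measure, h, h,
    interaction_mixtureKernel_comm hw β α, smul_eq_mul, smul_eq_mul]
  ring

theorem energy_eq {V : Space d → ℝ} (hV : Measurable V) (α : Measure (Space d))
    [IsProbabilityMeasure α] :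
    energy V α = 2⁻¹ * interaction coulombKernel α α + ∫⁻ x, ENNReal.ofReal (V x) ∂α := by
  have h : ∀ x, ∫⁻ y, (coulombKernel x y + ENNReal.ofReal (V x) + ENNReal.ofReal (V y)) ∂α
      = potential coulombKernel α x + ENNReal.ofReal (V x) + ∫⁻ x, ENNReal.ofReal (V x) ∂α := by
    intro x
    rw [lintegral_add_right _ (by fun_prop), lintegral_add_right _ (by fun_prop)]
    simp [potential]
  unfold energy
  simp only [h]
  rw [lintegral_add_right _ (by fun_prop), lintegral_add_right _ (by fun_prop)]
  simp only [lintegral_const, measure_univ, mul_one]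
  rw [add_assoc, ← two_mul, mul_add, ← mul_assoc, ENNReal.inv_mul_cancel two_ne_zero (by simp),
    one_mul]
  rfl

/-- A quadratic on `[0, 1]` that is minimal at `0` has nonnegative derivative there. Here `a`, `b`,
`e` play the interactions of `μ` with `μ`, `μ` with `ν`, `ν` with `ν`, and `l`, `k` the integrals of
`V` against `μ` and `ν`. -/
theorem le_of_forall_quadratic {a b e l k : ℝ}
    (h : ∀ t : ℝ, 0 ≤ t → t ≤ 1 →
      a / 2 + l ≤ ((1 - t) ^ 2 * a + 2 * (1 - t) * t * b + t ^ 2 * e) / 2 + ((1 - t) * l + t * k)) :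
    a + l ≤ b + k := by
  by_contra! hlt
  set D := (a + l) - (b + k) with hD
  set Q := |a - 2 * b + e| + 1 with hQ
  have hD0 : 0 < D := by linarith
  have hQ0 : 0 < Q := by positivity
  have hle : a - 2 * b + e ≤ Q := by rw [hQ]; linarith [le_abs_self (a - 2 * b + e)]
  -- Small enough that the quadratic term, at most `t² Q`, cannot offset the linear term `2 t D`,
  -- since `t Q ≤ D`.
  set t := D / (D + Q) with ht
  have ht0 : 0 < t := by positivity
  have ht1 : t ≤ 1 := by rw [ht, div_le_one (by positivity)]; linarith
  have h1 := h t ht0.le ht1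
  have h2 : t * (2 * D) ≤ t * (t * Q) := by
    have h3 : t * (t * (a - 2 * b + e)) ≤ t * (t * Q) := by gcongr
    have h4 : t * (2 * D) ≤ t * (t * (a - 2 * b + e)) := by rw [hD]; nlinarith
    linarith
  have h3 := le_of_mul_le_mul_left h2 ht0
  have h4 : t * Q ≤ D := by
    rw [ht, div_mul_eq_mul_div, div_le_iff₀ (by positivity)]; nlinarith
  linarith

/-- The modified Robin constant of a measure `μ` in the external field `V`. -/
def robinConstant (V : Space d → ℝ) (μ : Measure (Space d)) : ℝ≥0∞ :=
  interaction coulombKernel μ μ + ∫⁻ x, ENNReal.ofReal (V x) ∂μ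

/-- The first variation along the segment from `μ` to `ν`. Positive definiteness makes the mixed
interaction finite, so the inequality can be read in the reals. -/
theorem robinConstant_le_of_finite (hd : 3 ≤ d) {V : Space d → ℝ} (hV : Measurable V)
    {μ : Measure (Space d)} (hμ : IsEquilibriumMeasure V μ) (hC : robinConstant V μ ≠ ∞)
    (ν : Measure (Space d)) [IsProbabilityMeasure ν]
    (hν1 : interaction coulombKernel ν ν ≠ ∞) (hν2 : ∫⁻ x, ENNReal.ofReal (V x) ∂ν ≠ ∞) :
    robinConstant V μ ≤ ∫⁻ x, (potential coulombKernel μ x + ENNReal.ofReal (V x)) ∂ν := by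
  have := hμ.isProbabilityMeasure
  obtain ⟨hμ1, hμ2⟩ := ENNReal.add_ne_top.1 hC
  rw [lintegral_add_right _ (by fun_prop)]
  change robinConstant V μ ≤ interaction coulombKernel ν μ + _
  unfold robinConstant
  have key : ∀ t : ℝ, 0 ≤ t → t ≤ 1 →
      2⁻¹ * interaction coulombKernel μ μ + ∫⁻ x, ENNReal.ofReal (V x) ∂μ
      ≤ 2⁻¹ * (ENNReal.ofReal (1 - t) ^ 2 * interaction coulombKernel μ μ
          + 2 * ENNReal.ofReal (1 - t) * ENNReal.ofReal t * interaction coulombKernel ν μ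
          + ENNReal.ofReal t ^ 2 * interaction coulombKernel ν ν)
        + (ENNReal.ofReal (1 - t) * ∫⁻ x, ENNReal.ofReal (V x) ∂μ
          + ENNReal.ofReal t * ∫⁻ x, ENNReal.ofReal (V x) ∂ν) := by
    intro t ht0 ht1
    have hp : IsProbabilityMeasure (ENNReal.ofReal (1 - t) • μ + ENNReal.ofReal t • ν) := by
      constructor
      simp only [Measure.coe_add, Measure.coe_smul, Pi.add_apply, Pi.smul_apply, measure_univ,
        smul_eq_mul, mul_one]
      rw [← ENNReal.ofReal_add (by linarith) ht0]; simp
    have h := hμ.energy_le _ hp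
    rw [energy_eq hV, energy_eq hV, lintegral_add_measure, lintegral_smul_measure,
      lintegral_smul_measure, coulombKernel_eq_mixtureKernel hd,
      interaction_add_smul measurable_one] at h
    rw [coulombKernel_eq_mixtureKernel hd, interaction_mixtureKernel_comm measurable_one ν μ]
    exact h
  have hμν : interaction coulombKernel ν μ ≠ ∞ := by
    have h := two_mul_interaction_mixtureKernel_le measurable_one ν μ
    rw [← coulombKernel_eq_mixtureKernel hd] at h
    have h' := ne_top_of_le_ne_top (ENNReal.add_ne_top.2 ⟨hν1, hμ1⟩) h
    exact fun hI => h' (by rw [hI]; simp)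
  lift interaction coulombKernel μ μ to NNReal using hμ1 with a
  lift interaction coulombKernel ν μ to NNReal using hμν with b
  lift interaction coulombKernel ν ν to NNReal using hν1 with e
  lift ∫⁻ x, ENNReal.ofReal (V x) ∂μ to NNReal using hμ2 with l
  lift ∫⁻ x, ENNReal.ofReal (V x) ∂ν to NNReal using hν2 with k
  norm_cast
  rw [← NNReal.coe_le_coe]; push_cast
  refine le_of_forall_quadratic (e := e) fun t ht0 ht1 => ?_
  have h := key t ht0 ht1
  have h2 : (2 : ℝ≥0∞)⁻¹ = ((2⁻¹ : NNReal) : ℝ≥0∞) := by simp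
  rw [ENNReal.ofReal, ENNReal.ofReal, h2] at h
  norm_cast at h
  rw [← NNReal.coe_le_coe] at h; push_cast at h
  rw [Real.coe_toNNReal _ (by linarith), Real.coe_toNNReal _ ht0] at h
  linarith

/-- The uniform probability measure on `S`. -/
def uniformMeasure (S : Set (Space d)) : Measure (Space d) :=
  (volume S)⁻¹ • volume.restrict S

theorem isProbabilityMeasure_uniformMeasure {S : Set (Space d)} (h0 : volume S ≠ 0)
    (h1 : volume S ≠ ∞) : IsProbabilityMeasure (uniformMeasure S) := by
  constructor
  simp [uniformMeasure, ENNReal.inv_mul_cancel h0 h1]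

theorem ae_uniformMeasure_mem {S : Set (Space d)} (hS : MeasurableSet S) :
    ∀ᵐ x ∂uniformMeasure S, x ∈ S :=
  Measure.ae_smul_measure (ae_restrict_mem hS) _

/-- The potential is bounded: the density is at most `(volume S)⁻¹` and the short-time kernel has
finite mass, while the long-time kernel is bounded. -/
theorem interaction_uniformMeasure_ne_top (hd : 3 ≤ d) {S : Set (Space d)} (h0 : volume S ≠ 0)
    (h1 : volume S ≠ ∞) :
    interaction coulombKernel (uniformMeasure S) (uniformMeasure S) ≠ ∞ := by
  have := isProbabilityMeasure_uniformMeasure h0 h1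
  set B : ℝ≥0∞ := (volume S)⁻¹ * (∫⁻ t, shortTime 1 t ∂timeMeasure d)
    + ENNReal.ofReal (Real.exp (1 / 4) / (1 : ℝ) ^ (((d : ℝ) - 2) / 2)) with hB
  have hB' : B ≠ ∞ := ENNReal.add_ne_top.2
    ⟨ENNReal.mul_ne_top (ENNReal.inv_ne_top.2 h0) (lintegral_shortTime_ne_top 1),
      ENNReal.ofReal_ne_top⟩
  have hb : ∀ x, potential coulombKernel (uniformMeasure S) x ≤ B := by
    intro x
    rw [potential, coulombKernel_eq_mixtureKernel hd]
    simp only [← mixtureKernel_shortTime_add_longTime 1]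
    rw [lintegral_add_left (by fun_prop)]
    refine add_le_add ?_ ?_
    · rw [uniformMeasure, lintegral_smul_measure, smul_eq_mul,
        ← lintegral_mixtureKernel_shortTime 1 x]
      gcongr
      exact Measure.restrict_le_self
    · refine (lintegral_mono fun y => mixtureKernel_longTime_le hd one_pos x y).trans ?_
      simp
  refine ne_top_of_le_ne_top hB' ((lintegral_mono hb).trans ?_)
  simp

theorem lintegral_ofReal_uniformMeasure_ne_top {V : Space d → ℝ} (hV : Continuous V) {R : ℝ}
    {S : Set (Space d)} (hS : MeasurableSet S) (hSR : S ⊆ Metric.closedBall 0 R)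
    (h0 : volume S ≠ 0) (h1 : volume S ≠ ∞) :
    ∫⁻ x, ENNReal.ofReal (V x) ∂uniformMeasure S ≠ ∞ := by
  have := isProbabilityMeasure_uniformMeasure h0 h1
  obtain ⟨M, hM⟩ := (isCompact_closedBall (0 : Space d) R).bddAbove_image hV.continuousOn
  have : ∫⁻ x, ENNReal.ofReal (V x) ∂uniformMeasure S
      ≤ ∫⁻ x, ENNReal.ofReal M ∂uniformMeasure S := by
    refine lintegral_mono_ae ?_
    filter_upwards [ae_uniformMeasure_mem hS] with x hx
    exact ENNReal.ofReal_le_ofReal (hM ⟨x, hSR hx, rfl⟩)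
  refine ne_top_of_le_ne_top ?_ this
  simp

theorem robinConstant_ne_top (hd : 3 ≤ d) {V : Space d → ℝ} (hV : Continuous V)
    {μ : Measure (Space d)} (hμ : IsEquilibriumMeasure V μ) : robinConstant V μ ≠ ∞ := by
  have := hμ.isProbabilityMeasure
  have h0 : volume (Metric.closedBall (0 : Space d) 1) ≠ 0 :=
    (Metric.measure_closedBall_pos volume 0 one_pos).ne'
  have h1 : volume (Metric.closedBall (0 : Space d) 1) ≠ ∞ := measure_closedBall_lt_top.ne
  have hp := isProbabilityMeasure_uniformMeasure h0 h1
  have h := hμ.energy_le _ hp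
  rw [energy_eq hV.measurable, energy_eq hV.measurable] at h
  have h2 := ne_top_of_le_ne_top (ENNReal.add_ne_top.2 ⟨ENNReal.mul_ne_top (by simp)
    (interaction_uniformMeasure_ne_top hd h0 h1), lintegral_ofReal_uniformMeasure_ne_top hV
      Metric.isClosed_closedBall.measurableSet subset_rfl h0 h1⟩) h
  obtain ⟨h3, h4⟩ := ENNReal.add_ne_top.1 h2
  exact ENNReal.add_ne_top.2 ⟨fun hI => h3 (by rw [hI]; simp), h4⟩

@[fun_prop]
theorem measurable_potential_coulombKernel (hd : 3 ≤ d) (μ : Measure (Space d)) [SFinite μ] :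
    Measurable (potential coulombKernel μ) := by
  rw [coulombKernel_eq_mixtureKernel hd]; exact measurable_potential_mixtureKernel measurable_one μ

/-- The Euler-Lagrange inequality for the equilibrium measure. -/
theorem ae_robinConstant_le (hd : 3 ≤ d) {V : Space d → ℝ} (hV : Continuous V)
    {μ : Measure (Space d)} (hμ : IsEquilibriumMeasure V μ) :
    ∀ᵐ x, robinConstant V μ ≤ potential coulombKernel μ x + ENNReal.ofReal (V x) := by
  have := hμ.isProbabilityMeasure
  have hC := robinConstant_ne_top hd hV hμ
  have hW : Measurable fun x => potential coulombKernel μ x + ENNReal.ofReal (V x) :=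
    (measurable_potential_coulombKernel hd μ).add hV.measurable.ennreal_ofReal
  -- If the exceptional set had positive volume inside some ball, the uniform measure on that piece
  -- would have finite energy and contradict the first variation.
  set T : Set (Space d) :=
    {x | potential coulombKernel μ x + ENNReal.ofReal (V x) < robinConstant V μ} with hT
  have hTm : MeasurableSet T := measurableSet_lt hW measurable_const
  have hTn : ∀ n : ℕ, volume (T ∩ Metric.closedBall 0 n) = 0 := by
    intro n
    by_contra h0
    have hSm : MeasurableSet (T ∩ Metric.closedBall 0 n) :=
      hTm.inter Metric.isClosed_closedBall.measurableSet
    have h1 : volume (T ∩ Metric.closedBall 0 n) ≠ ∞ :=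
      measure_ne_top_of_subset Set.inter_subset_right measure_closedBall_lt_top.ne
    have hp := isProbabilityMeasure_uniformMeasure h0 h1
    have h := robinConstant_le_of_finite hd hV.measurable hμ hC _
      (interaction_uniformMeasure_ne_top hd h0 h1)
      (lintegral_ofReal_uniformMeasure_ne_top hV hSm Set.inter_subset_right h0 h1)
    have hlt := ae_uniformMeasure_mem hSm
    have hle : (fun x => potential coulombKernel μ x + ENNReal.ofReal (V x))
        ≤ᵐ[uniformMeasure (T ∩ Metric.closedBall 0 n)] fun _ => robinConstant V μ := by
      filter_upwards [hlt] with x hx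
      exact le_of_lt hx.1
    have heq := ae_eq_of_ae_le_of_lintegral_le hle ?_ aemeasurable_const (by simpa using h)
    · have : ∀ᵐ x ∂uniformMeasure (T ∩ Metric.closedBall 0 n), False := by
        filter_upwards [hlt, heq] with x hx hx'
        exact (ne_of_lt hx.1) hx'
      rw [Filter.eventually_false_iff_eq_bot, ae_eq_bot] at this
      exact hp.ne_zero _ this
    · exact ne_top_of_le_ne_top (by simpa using hC) (lintegral_mono_ae hle)
  have hT0 : volume T = 0 := by
    have : T = ⋃ n : ℕ, T ∩ Metric.closedBall 0 n := by
      rw [← Set.inter_iUnion, Metric.iUnion_closedBall_nat, Set.inter_univ]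
    rw [this]; exact measure_iUnion_null hTn
  rw [ae_iff]
  simpa only [not_le] using hT0

/-- The Euler-Lagrange equality on the equilibrium measure. -/
theorem ae_potential_add_eq_robinConstant (hd : 3 ≤ d) {V : Space d → ℝ} (hV : Continuous V)
    {μ : Measure (Space d)} (hμ : IsEquilibriumMeasure V μ) (hac : μ ≪ volume) :
    ∀ᵐ x ∂μ, potential coulombKernel μ x + ENNReal.ofReal (V x) = robinConstant V μ := by
  have := hμ.isProbabilityMeasure
  have hC := robinConstant_ne_top hd hV hμ
  have hW := measurable_potential_coulombKernel hd μ
  -- The two sides of the inequality have the same finite `μ`-integral, so they agree `μ`-a.e.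
  have h := ae_eq_of_ae_le_of_lintegral_le (hac.ae_le (ae_robinConstant_le hd hV hμ))
    (by simpa using hC) (hW.add hV.measurable.ennreal_ofReal).aemeasurable (by
      rw [lintegral_add_left hW]; simp [robinConstant, interaction])
  filter_upwards [h] with x hx
  exact hx.symm

/-! ### Smoothing: the Euler-Lagrange inequality at every point. -/

/-- The first-order terms cancel in the symmetric difference. The mean value inequality, used in
place of Taylor's formula, costs a harmless factor 2. -/
theorem add_sub_le_of_iteratedFDeriv_le {V : Space d → ℝ} (hV : ContDiff ℝ 2 V) {M : ℝ}
    (hM : ∀ x, ‖iteratedFDeriv ℝ 2 V x‖ ≤ M) (x y : Space d) :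
    V (x + y) + V (x - y) ≤ 2 * V x + 2 * M * ‖y‖ ^ 2 := by
  have hM0 : 0 ≤ M := (norm_nonneg _).trans (hM 0)
  have hdV : Differentiable ℝ V := hV.differentiable (by norm_num)
  have hd1 : Differentiable ℝ (fderiv ℝ V) :=
    (hV.fderiv_right (m := 1) (by norm_num)).differentiable (by norm_num)
  have h2 : ∀ a, ‖fderiv ℝ (fderiv ℝ V) a‖ ≤ M := by
    intro a
    rw [← norm_iteratedFDeriv_one, norm_iteratedFDeriv_fderiv]
    exact hM a
  have h1 : ∀ a b, ‖fderiv ℝ V a - fderiv ℝ V b‖ ≤ M * ‖a - b‖ := fun a b =>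
    convex_univ.norm_image_sub_le_of_norm_fderiv_le (fun c _ => hd1 c) (fun c _ => h2 c)
      (Set.mem_univ b) (Set.mem_univ a)
  have h0 : ∀ z, ‖z‖ = ‖y‖ → ‖V (x + z) - V x - fderiv ℝ V x z‖ ≤ M * ‖y‖ * ‖y‖ := by
    intro z hz
    have h := (convex_closedBall x ‖y‖).norm_image_sub_le_of_norm_fderiv_le' (f := V)
      (φ := fderiv ℝ V x) (C := M * ‖y‖) (fun c _ => hdV c) (fun c hc => by
        refine (h1 c x).trans ?_
        gcongr
        rwa [← dist_eq_norm, ← Metric.mem_closedBall])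
      (Metric.mem_closedBall_self (norm_nonneg y))
      (show x + z ∈ Metric.closedBall x ‖y‖ by simp [hz])
    simpa [hz] using h
  have ha := (abs_le.1 (h0 y rfl)).2
  have hb := (abs_le.1 (h0 (-y) (norm_neg y))).2
  rw [map_neg, ← sub_eq_add_neg] at hb
  nlinarith

/-- The constant bounding the second moment of the heat kernel. -/
def momentConstant (d : ℕ) : ℝ := 8 * 2 ^ ((d : ℝ) / 2)

theorem momentConstant_nonneg (d : ℕ) : 0 ≤ momentConstant d := by
  unfold momentConstant; positivity

/-- Half of the Gaussian exponent absorbs the factor `R`, by `r exp (-r) ≤ 1`; the other half is the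
Gaussian at time `2 s`. -/
theorem mul_heatProfile_le {s : ℝ} (hs : 0 < s) (R : ℝ) :
    R * heatProfile d s R ≤ momentConstant d * s * heatProfile d (2 * s) R := by
  have h1 : R / (8 * s) * Real.exp (-(R / (8 * s))) ≤ 1 := by
    rw [Real.exp_neg, ← div_eq_mul_inv, div_le_one (Real.exp_pos _)]
    linarith [Real.add_one_le_exp (R / (8 * s))]
  have h2 : Real.exp (-(R / (4 * s))) = Real.exp (-(R / (8 * s))) * Real.exp (-(R / (8 * s))) := by
    rw [← Real.exp_add]; congr 1; field_simp; ring
  have h3 : (4 * Real.pi * (2 * s)) ^ (-((d : ℝ) / 2))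
      = 2 ^ (-((d : ℝ) / 2)) * (4 * Real.pi * s) ^ (-((d : ℝ) / 2)) := by
    rw [← Real.mul_rpow (by norm_num) (by positivity)]; congr 1; ring
  have h4 : (2 : ℝ) ^ ((d : ℝ) / 2) * 2 ^ (-((d : ℝ) / 2)) = 1 := by
    rw [← Real.rpow_add two_pos, add_neg_cancel, Real.rpow_zero]
  unfold heatProfile momentConstant
  rw [h2, h3, show 4 * (2 * s) = 8 * s by ring]
  set e := Real.exp (-(R / (8 * s)))
  set c := (4 * Real.pi * s) ^ (-((d : ℝ) / 2))
  have hc : 0 ≤ c := by positivity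
  have he : 0 ≤ e := Real.exp_nonneg _
  calc R * (c * (e * e)) = (R / (8 * s) * e) * (8 * s * c * e) := by field_simp
    _ ≤ 1 * (8 * s * c * e) := by gcongr
    _ = 8 * (2 ^ ((d : ℝ) / 2) * 2 ^ (-((d : ℝ) / 2))) * s * c * e := by rw [h4]; ring
    _ = _ := by ring

theorem lintegral_sq_mul_heatKernel_le {s : ℝ} (hs : 0 < s) :
    ∫⁻ y : Space d, ENNReal.ofReal (‖y‖ ^ 2) * heatKernel s 0 y
      ≤ ENNReal.ofReal (momentConstant d * s) := by
  calc _ ≤ ∫⁻ y : Space d, ENNReal.ofReal (momentConstant d * s) * heatKernel (2 * s) 0 y := by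
        refine lintegral_mono fun y => ?_
        simp only [heatKernel, zero_sub, norm_neg]
        have := momentConstant_nonneg d
        rw [← ENNReal.ofReal_mul (by positivity), ← ENNReal.ofReal_mul (by positivity)]
        exact ENNReal.ofReal_le_ofReal (mul_heatProfile_le hs _)
    _ = _ := by
        rw [lintegral_const_mul _ (by fun_prop), lintegral_heatKernel (by positivity), mul_one]

theorem lintegral_mul_heatKernel_le {V : Space d → ℝ} (hV : ContDiff ℝ 2 V) (hV0 : ∀ x, 0 ≤ V x)
    {M : ℝ} (hM : ∀ x, ‖iteratedFDeriv ℝ 2 V x‖ ≤ M) {s : ℝ} (hs : 0 < s) (x : Space d) :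
    ∫⁻ y, ENNReal.ofReal (V y) * heatKernel s x y
      ≤ ENNReal.ofReal (V x) + ENNReal.ofReal (M * momentConstant d * s) := by
  have hM0 : 0 ≤ M := (norm_nonneg _).trans (hM 0)
  have hVm : Measurable V := hV.continuous.measurable
  have e1 : ∫⁻ y, ENNReal.ofReal (V y) * heatKernel s x y
      = ∫⁻ h, ENNReal.ofReal (V (x + h)) * heatKernel s 0 h := by
    rw [← lintegral_add_left_eq_self _ x]
    simp [heatKernel]
  have e2 : ∫⁻ y, ENNReal.ofReal (V y) * heatKernel s x y
      = ∫⁻ h, ENNReal.ofReal (V (x - h)) * heatKernel s 0 h := by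
    rw [← lintegral_sub_left_eq_self _ x]
    simp [heatKernel]
  -- Adding the substitutions `y = x + h` and `y = x - h` makes the symmetric difference of `V`
  -- appear.
  have h2 : 2 * ∫⁻ y, ENNReal.ofReal (V y) * heatKernel s x y
      ≤ 2 * (ENNReal.ofReal (V x) + ENNReal.ofReal (M * momentConstant d * s)) := by
    nth_rewrite 1 [two_mul, e1, e2]
    rw [← lintegral_add_left (by fun_prop)]
    calc _ ≤ ∫⁻ h : Space d, (2 * ENNReal.ofReal (V x) * heatKernel s 0 h
          + 2 * ENNReal.ofReal M * (ENNReal.ofReal (‖h‖ ^ 2) * heatKernel s 0 h)) := by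
          refine lintegral_mono fun h => ?_
          simp only
          rw [← add_mul, ← ENNReal.ofReal_add (hV0 _) (hV0 _), ← mul_assoc, ← add_mul]
          gcongr
          refine (ENNReal.ofReal_le_ofReal (add_sub_le_of_iteratedFDeriv_le hV hM x h)).trans ?_
          rw [ENNReal.ofReal_add (by have := hV0 x; positivity) (by positivity),
            ENNReal.ofReal_mul two_pos.le, ENNReal.ofReal_mul (by positivity),
            ENNReal.ofReal_mul two_pos.le, ENNReal.ofReal_ofNat]
      _ ≤ 2 * ENNReal.ofReal (V x) * 1
          + 2 * ENNReal.ofReal M * ENNReal.ofReal (momentConstant d * s) := by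
          rw [lintegral_add_left (by fun_prop), lintegral_const_mul _ (by fun_prop),
            lintegral_const_mul _ (by fun_prop), lintegral_heatKernel hs]
          gcongr
          exact lintegral_sq_mul_heatKernel_le hs
      _ = _ := by
          rw [mul_assoc M, ENNReal.ofReal_mul hM0]; ring
  exact (ENNReal.mul_le_mul_iff_right two_ne_zero (by simp)).1 h2

/-- The semigroup property turns time `t` into `t + s`, so smoothing the Coulomb potential by `p_s`
discards exactly the times up to `s`. -/
theorem lintegral_potential_mul_heatKernel {s : ℝ} (hs : 0 < s) (hd : 3 ≤ d)
    (μ : Measure (Space d)) [SFinite μ] (x : Space d) :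
    ∫⁻ y, potential coulombKernel μ y * heatKernel s x y
      = potential (mixtureKernel (longTime s)) μ x := by
  have h1 : ∀ t, 0 < t → ∫⁻ y, potential (heatKernel t) μ y * heatKernel s x y
      = potential (heatKernel (t + s)) μ x := by
    intro t ht
    have h2 : ∀ y, potential (heatKernel t) μ y * heatKernel s x y
        = ∫⁻ w, heatKernel s x y * heatKernel t y w ∂μ := by
      intro y
      rw [lintegral_const_mul _ (by fun_prop), mul_comm]; rfl
    simp only [h2]
    rw [lintegral_lintegral_swap (by fun_prop), add_comm t s]
    exact lintegral_congr fun w => lintegral_heatKernel_mul hs ht x w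
  have h3 : ∀ y, potential coulombKernel μ y * heatKernel s x y
      = ∫⁻ t, potential (heatKernel t) μ y * heatKernel s x y ∂timeMeasure d := by
    intro y
    rw [coulombKernel_eq_mixtureKernel hd, potential_mixtureKernel measurable_one,
      ← lintegral_mul_const _ (by fun_prop)]
    simp
  simp only [h3]
  rw [lintegral_lintegral_swap (by fun_prop), potential_mixtureKernel (by fun_prop)]
  have h4 : ∫⁻ t, (∫⁻ y, potential (heatKernel t) μ y * heatKernel s x y) ∂timeMeasure d
      = ∫⁻ t, potential (heatKernel (t + s)) μ x ∂timeMeasure d := by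
    refine lintegral_congr_ae ?_
    filter_upwards [ae_timeMeasure_pos d] with t ht
    exact h1 t ht
  rw [h4, lintegral_timeMeasure_add hs.le fun t => potential (heatKernel t) μ x,
    ← lintegral_indicator measurableSet_Ioi]
  congr 1; ext t
  by_cases ht : s < t <;> simp [longTime, Set.indicator, ht]

/-- The Euler-Lagrange inequality for the smoothed potential, valid at every point. -/
theorem robinConstant_le_longTime (hd : 3 ≤ d) {V : Space d → ℝ} (hV : ContDiff ℝ 2 V)
    (hV0 : ∀ x, 0 ≤ V x) {M : ℝ} (hM : ∀ x, ‖iteratedFDeriv ℝ 2 V x‖ ≤ M)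
    {μ : Measure (Space d)} (hμ : IsEquilibriumMeasure V μ) {s : ℝ} (hs : 0 < s) (x : Space d) :
    robinConstant V μ ≤ potential (mixtureKernel (longTime s)) μ x + ENNReal.ofReal (V x)
      + ENNReal.ofReal (M * momentConstant d * s) := by
  have := hμ.isProbabilityMeasure
  have hVm : Measurable V := hV.continuous.measurable
  have hW := measurable_potential_coulombKernel hd μ
  calc robinConstant V μ = ∫⁻ y, robinConstant V μ * heatKernel s x y := by
        rw [lintegral_const_mul _ (by fun_prop), lintegral_heatKernel hs, mul_one]
    _ ≤ ∫⁻ y, (potential coulombKernel μ y * heatKernel s x y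
          + ENNReal.ofReal (V y) * heatKernel s x y) := by
        refine lintegral_mono_ae ?_
        filter_upwards [ae_robinConstant_le hd hV.continuous hμ] with y hy
        rw [← add_mul]; gcongr
    _ = potential (mixtureKernel (longTime s)) μ x
          + ∫⁻ y, ENNReal.ofReal (V y) * heatKernel s x y := by
        rw [lintegral_add_right _ (by fun_prop), lintegral_potential_mul_heatKernel hs hd]
    _ ≤ _ := by
        rw [add_assoc]; gcongr
        exact lintegral_mul_heatKernel_le hV hV0 hM hs x

/-! ### The contact set and uniform bounds for potentials of the equilibrium measure. -/

/-- The set where the Euler-Lagrange inequality is an equality. -/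
def contactSet (V : Space d → ℝ) (μ : Measure (Space d)) : Set (Space d) :=
  {x | potential coulombKernel μ x + ENNReal.ofReal (V x) ≤ robinConstant V μ}

/-- The Coulomb kernel is continuous into `[0, ∞]`, so by Fatou's lemma the potential is lower
semicontinuous. -/
theorem isClosed_contactSet (hd : 3 ≤ d) {V : Space d → ℝ} (hV : Continuous V)
    (μ : Measure (Space d)) [IsProbabilityMeasure μ] : IsClosed (contactSet V μ) := by
  refine IsSeqClosed.isClosed fun u x hu hux => ?_
  have hm : ∀ z : Space d, Measurable fun y => coulombKernel z y := by
    intro z; rw [coulombKernel_eq_mixtureKernel hd]; fun_prop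
  have h1 : ∀ z, potential coulombKernel μ z + ENNReal.ofReal (V z)
      = ∫⁻ y, (coulombKernel z y + ENNReal.ofReal (V z)) ∂μ := by
    intro z
    rw [lintegral_add_left (hm z)]; simp [potential]
  have h2 : ∀ y, Tendsto (fun k => coulombKernel (u k) y + ENNReal.ofReal (V (u k))) atTop
      (𝓝 (coulombKernel x y + ENNReal.ofReal (V x))) := by
    intro y
    refine Tendsto.add ?_ ?_
    · have : Continuous fun z : Space d => coulombKernel z y := by
        unfold coulombKernel
        exact ((ENNReal.continuous_pow _).comp (continuous_id.edist continuous_const)).inv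
      exact (this.tendsto x).comp hux
    · exact ((ENNReal.continuous_ofReal.comp hV).tendsto x).comp hux
  change potential coulombKernel μ x + ENNReal.ofReal (V x) ≤ robinConstant V μ
  rw [h1]
  calc _ = ∫⁻ y, liminf (fun k => coulombKernel (u k) y + ENNReal.ofReal (V (u k))) atTop ∂μ :=
        lintegral_congr fun y => (h2 y).liminf_eq.symm
    _ ≤ liminf (fun k => ∫⁻ y, (coulombKernel (u k) y + ENNReal.ofReal (V (u k))) ∂μ) atTop :=
        lintegral_liminf_le fun k => (hm _).add measurable_const
    _ ≤ liminf (fun _ : ℕ => robinConstant V μ) atTop := by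
        refine liminf_le_liminf (Eventually.of_forall fun k => ?_)
        rw [← h1]; exact hu k
    _ = _ := by simp

/-- The constant in the comparison of a potential with its values on the support. -/
def doublingConstant (d : ℕ) : ℝ≥0∞ := ENNReal.ofReal ((1 / 4) ^ (-((d : ℝ) / 2)))

/-- Passing from `t` to `t / 4` compensates a doubled distance: `p_{t/4}` at squared distance `R` is
`2^d p_t` at `4 R`. The condition on `w` offsets the Jacobian `1 / 4`. -/
theorem mixtureKernel_le_doublingConstant_mul {w : ℝ → ℝ≥0∞} (hw : Measurable w)
    (hw4 : ∀ t, 0 < t → w (1 / 4 * t) ≤ 4 * w t) {x x' y : Space d}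
    (h : ‖x' - y‖ ≤ 2 * ‖x - y‖) :
    mixtureKernel w x y ≤ doublingConstant d * mixtureKernel w x' y := by
  unfold mixtureKernel
  rw [lintegral_timeMeasure_eq_mul (show (0 : ℝ) < 1 / 4 by norm_num),
    ← lintegral_const_mul _ (by fun_prop), ← lintegral_const_mul _ (by fun_prop)]
  refine lintegral_mono_ae ?_
  filter_upwards [ae_timeMeasure_pos d] with t ht
  have h1 : heatKernel (1 / 4 * t) x y ≤ doublingConstant d * heatKernel t x' y := by
    rw [doublingConstant, heatKernel, heatKernel, ← ENNReal.ofReal_mul (by positivity)]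
    refine ENNReal.ofReal_le_ofReal ?_
    have := heatProfile_scale (d := d) (R := 4 * ‖x - y‖ ^ 2) (show (0 : ℝ) < 1 / 4 by norm_num) ht
    rw [show 1 / 4 * (4 * ‖x - y‖ ^ 2) = ‖x - y‖ ^ 2 by ring] at this
    rw [this]
    gcongr
    refine heatProfile_anti ht ?_
    nlinarith [norm_nonneg (x' - y)]
  have h4 : ENNReal.ofReal (1 / 4) * 4 = 1 := by
    rw [← ENNReal.ofReal_ofNat, ← ENNReal.ofReal_mul (by norm_num)]; norm_num
  calc _ ≤ ENNReal.ofReal (1 / 4) * (4 * w t * (doublingConstant d * heatKernel t x' y)) := by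
        gcongr; exact hw4 t ht
    _ = (ENNReal.ofReal (1 / 4) * 4) * (doublingConstant d * (w t * heatKernel t x' y)) := by ring
    _ = _ := by rw [h4, one_mul]

/-- A substitute for the maximum principle: if `x'` is a point of `S` nearest to `x`, then `|x' - y|
≤ 2 |x - y|` for all `y` in `S`, so the potential at `x` is controlled by the one at `x'`. -/
theorem potential_le_of_forall_mem {w : ℝ → ℝ≥0∞} (hw : Measurable w)
    (hw4 : ∀ t, 0 < t → w (1 / 4 * t) ≤ 4 * w t) {μ : Measure (Space d)} [IsProbabilityMeasure μ]
    {S : Set (Space d)} (hS : IsClosed S) (hμS : ∀ᵐ x ∂μ, x ∈ S) {B : ℝ≥0∞}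
    (hB : ∀ x ∈ S, potential (mixtureKernel w) μ x ≤ B) (x : Space d) :
    potential (mixtureKernel w) μ x ≤ doublingConstant d * B := by
  have hne : S.Nonempty := hμS.exists
  obtain ⟨x', hx', hdist⟩ := hS.exists_infDist_eq_dist hne x
  calc _ ≤ ∫⁻ y, doublingConstant d * mixtureKernel w x' y ∂μ := by
        refine lintegral_mono_ae ?_
        filter_upwards [hμS] with y hy
        refine mixtureKernel_le_doublingConstant_mul hw hw4 ?_
        have h1 : dist x x' ≤ dist x y := hdist ▸ Metric.infDist_le_dist_of_mem hy
        have h2 := dist_triangle_left x' y x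
        rw [← dist_eq_norm, ← dist_eq_norm]; linarith
    _ = doublingConstant d * potential (mixtureKernel w) μ x' := by
        rw [lintegral_const_mul _ (by fun_prop)]; rfl
    _ ≤ _ := by gcongr; exact hB x' hx'

/-- The weight `1 - exp (-q / (4 t))`. -/
def coscreening (q t : ℝ) : ℝ≥0∞ := ENNReal.ofReal (1 - Real.exp (-(q / (4 * t))))

@[fun_prop]
theorem measurable_coscreening (q : ℝ) : Measurable (coscreening q) := by
  unfold coscreening; fun_prop

theorem screening_add_coscreening {q t : ℝ} (hq : 0 ≤ q) (ht : 0 < t) :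
    screening q t + coscreening q t = 1 := by
  have : Real.exp (-(q / (4 * t))) ≤ 1 := by
    rw [Real.exp_le_one_iff, Left.neg_nonpos_iff]; positivity
  rw [screening, coscreening, ← ENNReal.ofReal_add (Real.exp_nonneg _) (by linarith)]
  simp

/-- With `a = exp (-q / (4 t))` this is `1 - a⁴ ≤ 4 (1 - a)`; it makes the weight admissible in
`potential_le_of_forall_mem`. -/
theorem coscreening_quarter_le {q t : ℝ} (hq : 0 ≤ q) (ht : 0 < t) :
    coscreening q (1 / 4 * t) ≤ 4 * coscreening q t := by
  rw [coscreening, coscreening, ← ENNReal.ofReal_ofNat, ← ENNReal.ofReal_mul (by norm_num)]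
  refine ENNReal.ofReal_le_ofReal ?_
  have h1 : Real.exp (-(q / (4 * t))) ≤ 1 := by
    rw [Real.exp_le_one_iff, Left.neg_nonpos_iff]; positivity
  have h2 : Real.exp (-(q / (4 * (1 / 4 * t)))) = Real.exp (-(q / (4 * t))) ^ 4 := by
    rw [← Real.exp_nat_mul]; congr 1; field_simp; norm_num
  rw [h2]
  have h0 := Real.exp_nonneg (-(q / (4 * t)))
  set a := Real.exp (-(q / (4 * t)))
  have h3 : 0 ≤ (1 - a) * (3 - a - a ^ 2 - a ^ 3) := by
    refine mul_nonneg (by linarith) ?_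
    have := pow_le_one₀ h0 h1 (n := 2)
    have := pow_le_one₀ h0 h1 (n := 3)
    linarith
  nlinarith

theorem coscreening_le {q s t : ℝ} (hq : 0 ≤ q) (hs : 0 < s) (ht : 0 < t) :
    coscreening q t ≤ shortTime s t + ENNReal.ofReal (q / (4 * s)) := by
  by_cases h : t ≤ s
  · have : shortTime s t = 1 := by simp [shortTime, Set.indicator, h]
    rw [this]
    refine le_add_right ?_
    rw [← screening_add_coscreening hq ht]; exact le_add_self
  · refine le_add_left (ENNReal.ofReal_le_ofReal ?_)
    have h1 := Real.add_one_le_exp (-(q / (4 * t)))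
    have h2 : q / (4 * t) ≤ q / (4 * s) := by gcongr; exact (not_le.1 h).le
    linarith

theorem potential_add {v w : ℝ → ℝ≥0∞} (hv : Measurable v) (μ : Measure (Space d)) (z : Space d) :
    potential (mixtureKernel fun t => v t + w t) μ z
      = potential (mixtureKernel v) μ z + potential (mixtureKernel w) μ z := by
  simp only [potential, mixtureKernel_add hv]
  rw [lintegral_add_left (by fun_prop)]

theorem potential_coulombKernel_eq_add (hd : 3 ≤ d) {q : ℝ} (hq : 0 ≤ q) (μ : Measure (Space d))
    (z : Space d) :
    potential coulombKernel μ z = potential (mixtureKernel (screening q)) μ z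
      + potential (mixtureKernel (coscreening q)) μ z := by
  rw [coulombKernel_eq_mixtureKernel hd, ← potential_add (by fun_prop)]
  refine lintegral_congr fun y => lintegral_congr_ae ?_
  filter_upwards [ae_timeMeasure_pos d] with t ht
  rw [screening_add_coscreening hq ht, Pi.one_apply]

theorem ae_mem_contactSet (hd : 3 ≤ d) {V : Space d → ℝ} (hV : Continuous V)
    {μ : Measure (Space d)} (hμ : IsEquilibriumMeasure V μ) (hac : μ ≪ volume) :
    ∀ᵐ x ∂μ, x ∈ contactSet V μ := by
  filter_upwards [ae_potential_add_eq_robinConstant hd hV hμ hac] with x hx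
  exact hx.le

/-- The potential of the equilibrium measure is bounded. -/
theorem potential_coulombKernel_le (hd : 3 ≤ d) {V : Space d → ℝ} (hV : Continuous V)
    {μ : Measure (Space d)} (hμ : IsEquilibriumMeasure V μ) (hac : μ ≪ volume) (z : Space d) :
    potential coulombKernel μ z ≤ doublingConstant d * robinConstant V μ := by
  have := hμ.isProbabilityMeasure
  have hS := isClosed_contactSet hd hV μ
  have h := ae_mem_contactSet hd hV hμ hac
  rw [coulombKernel_eq_mixtureKernel hd]
  refine potential_le_of_forall_mem measurable_one (fun t _ => ?_) hS h (fun x hx => ?_) z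
  · simp only [Pi.one_apply, mul_one]; norm_num
  · rw [← coulombKernel_eq_mixtureKernel hd]
    exact le_self_add.trans hx

theorem potential_coulombKernel_ne_top (hd : 3 ≤ d) {V : Space d → ℝ} (hV : Continuous V)
    {μ : Measure (Space d)} (hμ : IsEquilibriumMeasure V μ) (hac : μ ≪ volume) (z : Space d) :
    potential coulombKernel μ z ≠ ∞ :=
  ne_top_of_le_ne_top (ENNReal.mul_ne_top ENNReal.ofReal_ne_top (robinConstant_ne_top hd hV hμ))
    (potential_coulombKernel_le hd hV hμ hac z)

/-- At a contact point `U + V ≤ C`, while smoothing gives `C ≤ U_s + V + O(s)`; the difference is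
the short-time part of `U`. -/
theorem potential_shortTime_le_of_mem (hd : 3 ≤ d) {V : Space d → ℝ} (hV : ContDiff ℝ 2 V)
    (hV0 : ∀ x, 0 ≤ V x) {M : ℝ} (hM : ∀ x, ‖iteratedFDeriv ℝ 2 V x‖ ≤ M)
    {μ : Measure (Space d)} (hμ : IsEquilibriumMeasure V μ) {s : ℝ} (hs : 0 < s)
    {x : Space d} (hx : x ∈ contactSet V μ) :
    potential (mixtureKernel (shortTime s)) μ x ≤ ENNReal.ofReal (M * momentConstant d * s) := by
  have hC := robinConstant_ne_top hd hV.continuous hμ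
  have h1 : potential coulombKernel μ x = potential (mixtureKernel (shortTime s)) μ x
      + potential (mixtureKernel (longTime s)) μ x := by
    rw [coulombKernel_eq_mixtureKernel hd, ← potential_add (by fun_prop)]
    simp only [shortTime_add_longTime]; rfl
  have h2 : potential (mixtureKernel (shortTime s)) μ x
      + (potential (mixtureKernel (longTime s)) μ x + ENNReal.ofReal (V x))
      ≤ robinConstant V μ := by
    rw [← add_assoc, ← h1]; exact hx
  have h3 := h2.trans (robinConstant_le_longTime hd hV hV0 hM hμ hs x)
  rw [add_comm] at h3
  exact (ENNReal.add_le_add_iff_left (ne_top_of_le_ne_top hC (le_add_self.trans h2))).1 h3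

/-- The regularized potentials of the equilibrium measure are uniformly close to its Coulomb
potential. -/
theorem potential_coscreening_le (hd : 3 ≤ d) {V : Space d → ℝ} (hV : ContDiff ℝ 2 V)
    (hV0 : ∀ x, 0 ≤ V x) {M : ℝ} (hM : ∀ x, ‖iteratedFDeriv ℝ 2 V x‖ ≤ M)
    {μ : Measure (Space d)} (hμ : IsEquilibriumMeasure V μ) (hac : μ ≪ volume)
    {q s : ℝ} (hq : 0 ≤ q) (hs : 0 < s) (z : Space d) :
    potential (mixtureKernel (coscreening q)) μ z
      ≤ doublingConstant d * (ENNReal.ofReal (M * momentConstant d * s)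
        + ENNReal.ofReal (q / (4 * s)) * robinConstant V μ) := by
  have := hμ.isProbabilityMeasure
  refine potential_le_of_forall_mem (by fun_prop) (fun t ht => coscreening_quarter_le hq ht)
    (isClosed_contactSet hd hV.continuous μ) (ae_mem_contactSet hd hV.continuous hμ hac)
    (fun x hx => ?_) z
  -- The cutoff `s` is free: the short-time error grows with `s`, and the other error decreases like
  -- `q / (4 s)`.
  have h1 : potential (mixtureKernel (coscreening q)) μ x
      ≤ potential (mixtureKernel fun t =>
          shortTime s t + ENNReal.ofReal (q / (4 * s)) * (1 : ℝ → ℝ≥0∞) t) μ x :=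
    lintegral_mono fun y => mixtureKernel_mono
      (fun t ht => by simpa using coscreening_le hq hs ht) x y
  refine h1.trans ?_
  rw [potential_add (by fun_prop)]
  refine add_le_add (potential_shortTime_le_of_mem hd hV hV0 hM hμ hs hx) ?_
  simp only [potential, mixtureKernel_const_mul measurable_one]
  rw [lintegral_const_mul _ (by fun_prop)]
  gcongr
  rw [← coulombKernel_eq_mixtureKernel hd]
  exact le_self_add.trans hx

/-! ### Discrete energy and the deterministic estimate. -/

theorem lintegral_empiricalMeasure {n : ℕ} (x : Fin n → Space d) (f : Space d → ℝ≥0∞) :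
    ∫⁻ y, f y ∂empiricalMeasure x = (n : ℝ≥0∞)⁻¹ * ∑ i, f (x i) := by
  simp [empiricalMeasure, lintegral_smul_measure]

theorem isProbabilityMeasure_empiricalMeasure {n : ℕ} (hn : n ≠ 0) (x : Fin n → Space d) :
    IsProbabilityMeasure (empiricalMeasure x) := by
  constructor
  have h := lintegral_empiricalMeasure x 1
  simp only [Pi.one_apply, lintegral_one, Finset.sum_const, Finset.card_univ, Fintype.card_fin,
    nsmul_eq_mul, mul_one] at h
  rw [h, ENNReal.inv_mul_cancel (by exact_mod_cast hn) (ENNReal.natCast_ne_top n)]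

theorem coulombKernel_ne_top (hd : 3 ≤ d) {x y : Space d} (hxy : x ≠ y) :
    coulombKernel x y ≠ ∞ := by
  rw [coulombKernel_eq_ofReal hd hxy]; exact ENNReal.ofReal_ne_top

/-- Injectivity keeps the off-diagonal kernel values finite, so the `toReal` in `discreteEnergy`
loses nothing. -/
theorem two_mul_ofReal_discreteEnergy (hd : 3 ≤ d) {V : Space d → ℝ} (hV0 : ∀ x, 0 ≤ V x) {n : ℕ}
    (hn : n ≠ 0) {x : Fin n → Space d} (hx : Function.Injective x) :
    2 * ENNReal.ofReal (discreteEnergy V n x)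
      = (n : ℝ≥0∞)⁻¹ * ((n : ℝ≥0∞)⁻¹
          * ∑ i, ∑ j, if i ≠ j then coulombKernel (x i) (x j) else 0)
        + 2 * ∫⁻ y, ENNReal.ofReal (V y) ∂empiricalMeasure x := by
  have hn0 : (0 : ℝ) < n := by positivity
  have hinv : ENNReal.ofReal (1 / (n : ℝ)) = (n : ℝ≥0∞)⁻¹ := by
    rw [one_div, ENNReal.ofReal_inv_of_pos hn0, ENNReal.ofReal_natCast]
  have hterm : ∀ i j, 0 ≤ (if i ≠ j then (coulombKernel (x i) (x j)).toReal else 0) := by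
    intro i j; split_ifs <;> positivity
  have hS : ENNReal.ofReal (∑ i : Fin n, ∑ j : Fin n,
      if i ≠ j then (coulombKernel (x i) (x j)).toReal else 0)
      = ∑ i, ∑ j, if i ≠ j then coulombKernel (x i) (x j) else 0 := by
    rw [ENNReal.ofReal_sum_of_nonneg fun i _ => Finset.sum_nonneg fun j _ => hterm i j]
    refine Finset.sum_congr rfl fun i _ => ?_
    rw [ENNReal.ofReal_sum_of_nonneg fun j _ => hterm i j]
    refine Finset.sum_congr rfl fun j _ => ?_
    by_cases h : i = j
    · simp [h]
    · simp only [ne_eq, h, not_false_eq_true, if_true]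
      exact ENNReal.ofReal_toReal (coulombKernel_ne_top hd fun h' => h (hx h'))
  have h2 : ∀ a : ℝ, 2 * ENNReal.ofReal a = ENNReal.ofReal (2 * a) := by
    intro a; rw [ENNReal.ofReal_mul two_pos.le, ENNReal.ofReal_ofNat]
  rw [lintegral_empiricalMeasure, ← ENNReal.ofReal_sum_of_nonneg fun i _ => hV0 (x i), ← hS,
    ← hinv, h2, ← ENNReal.ofReal_mul (by positivity), ← ENNReal.ofReal_mul (by positivity),
    ← ENNReal.ofReal_mul (by positivity), h2,
    ← ENNReal.ofReal_add]
  · congr 1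
    unfold discreteEnergy
    field_simp
  · exact mul_nonneg (by positivity) (mul_nonneg (by positivity)
      (Finset.sum_nonneg fun i _ => Finset.sum_nonneg fun j _ => hterm i j))
  · exact mul_nonneg two_pos.le (mul_nonneg (by positivity) (Finset.sum_nonneg fun i _ => hV0 _))

theorem discreteEnergy_nonneg {V : Space d → ℝ} (hV0 : ∀ x, 0 ≤ V x) (n : ℕ)
    (x : Fin n → Space d) : 0 ≤ discreteEnergy V n x := by
  unfold discreteEnergy
  refine add_nonneg (mul_nonneg (by positivity) (Finset.sum_nonneg fun i _ =>
    Finset.sum_nonneg fun j _ => ?_))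
    (mul_nonneg (by positivity) (Finset.sum_nonneg fun i _ => hV0 _))
  split_ifs <;> positivity

/-- The bound on the heat kernels integrated over times larger than `s`. -/
def longTimeBound (d : ℕ) (s : ℝ) : ℝ := Real.exp (1 / 4) / s ^ (((d : ℝ) - 2) / 2)

/-- Dropping the times up to `s` only lowers the off-diagonal terms and makes the `n` diagonal ones
finite; with the normalization `1 / n²` these add `longTimeBound d s / n`. -/
theorem interaction_longTime_empiricalMeasure_le (hd : 3 ≤ d) {V : Space d → ℝ}
    (hV0 : ∀ x, 0 ≤ V x) {n : ℕ} (hn : n ≠ 0) {x : Fin n → Space d} (hx : Function.Injective x)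
    {s : ℝ} (hs : 0 < s) :
    interaction (mixtureKernel (longTime s)) (empiricalMeasure x) (empiricalMeasure x)
        + 2 * ∫⁻ y, ENNReal.ofReal (V y) ∂empiricalMeasure x
      ≤ 2 * ENNReal.ofReal (discreteEnergy V n x)
        + (n : ℝ≥0∞)⁻¹ * ENNReal.ofReal (longTimeBound d s) := by
  have hn' : (n : ℝ≥0∞)⁻¹ * n = 1 :=
    ENNReal.inv_mul_cancel (by exact_mod_cast hn) (ENNReal.natCast_ne_top n)
  have h : interaction (mixtureKernel (longTime s)) (empiricalMeasure x) (empiricalMeasure x)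
      ≤ (n : ℝ≥0∞)⁻¹ * ((n : ℝ≥0∞)⁻¹
          * ∑ i, ∑ j, if i ≠ j then coulombKernel (x i) (x j) else 0)
        + (n : ℝ≥0∞)⁻¹ * ENNReal.ofReal (longTimeBound d s) := by
    simp only [interaction, potential, lintegral_empiricalMeasure]
    rw [← Finset.mul_sum]
    have h1 : ∀ i, ∑ j, mixtureKernel (longTime s) (x i) (x j)
        ≤ (∑ j, if i ≠ j then coulombKernel (x i) (x j) else 0)
          + ENNReal.ofReal (longTimeBound d s) := by
      intro i
      have h2 : ∀ j, mixtureKernel (longTime s) (x i) (x j)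
          ≤ (if i ≠ j then coulombKernel (x i) (x j) else 0)
            + if i = j then ENNReal.ofReal (longTimeBound d s) else 0 := by
        intro j
        by_cases hij : i = j
        · simp only [hij, ne_eq, not_true_eq_false, if_false, if_true, zero_add]
          exact mixtureKernel_longTime_le hd hs _ _
        · simp only [hij, ne_eq, not_false_eq_true, if_false, if_true, add_zero]
          rw [coulombKernel_eq_mixtureKernel hd]
          exact mixtureKernel_mono (fun t _ => longTime_le_one s t) _ _
      refine (Finset.sum_le_sum fun j _ => h2 j).trans ?_
      rw [Finset.sum_add_distrib]; simp
    calc _ ≤ (n : ℝ≥0∞)⁻¹ * ((n : ℝ≥0∞)⁻¹ * ∑ i,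
            ((∑ j, if i ≠ j then coulombKernel (x i) (x j) else 0)
              + ENNReal.ofReal (longTimeBound d s))) := by
          gcongr with i; exact h1 i
      _ = (n : ℝ≥0∞)⁻¹ * ((n : ℝ≥0∞)⁻¹
            * ∑ i, ∑ j, if i ≠ j then coulombKernel (x i) (x j) else 0)
          + (n : ℝ≥0∞)⁻¹ * (((n : ℝ≥0∞)⁻¹ * n) * ENNReal.ofReal (longTimeBound d s)) := by
          rw [Finset.sum_add_distrib]
          simp only [Finset.sum_const, Finset.card_univ, Fintype.card_fin, nsmul_eq_mul]
          ring
      _ = _ := by rw [hn', one_mul]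
  rw [two_mul_ofReal_discreteEnergy hd hV0 hn hx]
  calc _ ≤ _ := add_le_add_left h _
    _ = _ := by ring

/-- A lower bound for the discrete energy in terms of regularized interactions. -/
theorem interaction_add_robinConstant_le (hd : 3 ≤ d) {V : Space d → ℝ} (hV : ContDiff ℝ 2 V)
    (hV0 : ∀ x, 0 ≤ V x) {M : ℝ} (hM : ∀ x, ‖iteratedFDeriv ℝ 2 V x‖ ≤ M)
    {μ : Measure (Space d)} (hμ : IsEquilibriumMeasure V μ) {n : ℕ} (hn : n ≠ 0)
    {x : Fin n → Space d} (hx : Function.Injective x) {s : ℝ} (hs : 0 < s) :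
    interaction (mixtureKernel (longTime s)) (empiricalMeasure x) (empiricalMeasure x)
        + 2 * robinConstant V μ
      ≤ 2 * ENNReal.ofReal (discreteEnergy V n x)
        + (n : ℝ≥0∞)⁻¹ * ENNReal.ofReal (longTimeBound d s)
        + 2 * interaction (mixtureKernel (longTime s)) (empiricalMeasure x) μ
        + 2 * ENNReal.ofReal (M * momentConstant d * s) := by
  have := hμ.isProbabilityMeasure
  have := isProbabilityMeasure_empiricalMeasure hn x
  have hVm : Measurable V := hV.continuous.measurable
  -- The atoms of the empirical measure form a Lebesgue null set, so the inequality is needed at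
  -- every point and not just almost everywhere.
  have h1 : robinConstant V μ
      ≤ interaction (mixtureKernel (longTime s)) (empiricalMeasure x) μ
        + ∫⁻ y, ENNReal.ofReal (V y) ∂empiricalMeasure x
        + ENNReal.ofReal (M * momentConstant d * s) := by
    calc robinConstant V μ = ∫⁻ _, robinConstant V μ ∂empiricalMeasure x := by simp
      _ ≤ ∫⁻ y, (potential (mixtureKernel (longTime s)) μ y + ENNReal.ofReal (V y)
            + ENNReal.ofReal (M * momentConstant d * s)) ∂empiricalMeasure x :=
          lintegral_mono fun y => robinConstant_le_longTime hd hV hV0 hM hμ hs y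
      _ = _ := by
          rw [lintegral_add_left (by fun_prop), lintegral_add_left (by fun_prop)]
          simp [interaction]
  calc _ ≤ interaction (mixtureKernel (longTime s)) (empiricalMeasure x) (empiricalMeasure x)
        + 2 * (interaction (mixtureKernel (longTime s)) (empiricalMeasure x) μ
        + ∫⁻ y, ENNReal.ofReal (V y) ∂empiricalMeasure x
        + ENNReal.ofReal (M * momentConstant d * s)) := by gcongr
    _ = (interaction (mixtureKernel (longTime s)) (empiricalMeasure x) (empiricalMeasure x)
        + 2 * ∫⁻ y, ENNReal.ofReal (V y) ∂empiricalMeasure x)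
        + (2 * interaction (mixtureKernel (longTime s)) (empiricalMeasure x) μ
          + 2 * ENNReal.ofReal (M * momentConstant d * s)) := by ring
    _ ≤ _ := add_le_add_left (interaction_longTime_empiricalMeasure_le hd hV0 hn hx hs) _
    _ = _ := by ring

/-- For `t ≤ s` half of the exponent `q / (4 t)` is at least `q / (8 s)`, and the other half is a
weight with bounded kernel. The remainder is negligible once `s` is much smaller than `q`. -/
theorem mixtureKernel_screening_le (hd : 3 ≤ d) {q : ℝ} (hq : 0 < q) (s : ℝ)
    (x y : Space d) :
    mixtureKernel (screening q) x y
      ≤ mixtureKernel (fun t => longTime s t * screening q t) x y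
        + ENNReal.ofReal (Real.exp (-(q / (8 * s))) / (q / 2) ^ (((d : ℝ) - 2) / 2)) := by
  have h : ∀ t, 0 < t → screening q t ≤ longTime s t * screening q t
      + ENNReal.ofReal (Real.exp (-(q / (8 * s)))) * screening (q / 2) t := by
    intro t ht
    by_cases h : s < t
    · have : longTime s t = 1 := by simp [longTime, Set.indicator, h]
      rw [this, one_mul]; exact le_self_add
    · refine le_add_left ?_
      rw [screening, screening, ← ENNReal.ofReal_mul (Real.exp_nonneg _), ← Real.exp_add]
      refine ENNReal.ofReal_le_ofReal (Real.exp_le_exp.2 ?_)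
      have h1 : q / (8 * s) ≤ q / (8 * t) := by gcongr; exact not_lt.1 h
      have h2 : q / (4 * t) = q / (8 * t) + q / 2 / (4 * t) := by field_simp; norm_num
      linarith
  refine (mixtureKernel_mono h x y).trans ?_
  rw [mixtureKernel_add (by fun_prop), mixtureKernel_const_mul (by fun_prop)]
  gcongr
  refine (mul_le_mul_right (mixtureKernel_le_self _ x y 0) _).trans ?_
  rw [mixtureKernel_screening hd (by positivity), ← ENNReal.ofReal_mul (Real.exp_nonneg _)]
  simp [div_eq_mul_inv]

/-- The Coulomb energy of a measure in the external field `V`, as a real number. -/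
def realEnergy (V : Space d → ℝ) (μ : Measure (Space d)) : ℝ :=
  (interaction coulombKernel μ μ).toReal / 2 + (∫⁻ x, ENNReal.ofReal (V x) ∂μ).toReal

theorem potential_le_of_le {K : Space d → Space d → ℝ≥0∞} {B : ℝ≥0∞} (h : ∀ x y, K x y ≤ B)
    (μ : Measure (Space d)) [IsProbabilityMeasure μ] (z : Space d) : potential K μ z ≤ B :=
  (lintegral_mono fun y => h z y).trans (by simp)

theorem interaction_le_of_le {K : Space d → Space d → ℝ≥0∞} {B : ℝ≥0∞} (h : ∀ x y, K x y ≤ B)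
    (μ ν : Measure (Space d)) [IsProbabilityMeasure μ] [IsProbabilityMeasure ν] :
    interaction K μ ν ≤ B :=
  (lintegral_mono fun y => potential_le_of_le h ν y).trans (by simp)

/-- The difference of regularized potentials is controlled by the excess energy. -/
theorem abs_potential_longTime_sub_le (hd : 3 ≤ d) {V : Space d → ℝ} (hV : ContDiff ℝ 2 V)
    (hV0 : ∀ x, 0 ≤ V x) {M : ℝ} (hM : ∀ x, ‖iteratedFDeriv ℝ 2 V x‖ ≤ M)
    {μ : Measure (Space d)} (hμ : IsEquilibriumMeasure V μ) {n : ℕ} (hn : n ≠ 0)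
    {x : Fin n → Space d} (hx : Function.Injective x) {s q c : ℝ} (hs : 0 < s) (hq : 0 < q)
    (hc : 0 < c) (z : Space d) :
    |(potential (mixtureKernel fun t => longTime s t * screening q t)
          (empiricalMeasure x) z).toReal
        - (potential (mixtureKernel fun t => longTime s t * screening q t) μ z).toReal|
      ≤ (2 * (discreteEnergy V n x - realEnergy V μ) + longTimeBound d s / n
          + 2 * (M * momentConstant d * s) + c ^ 2 / q ^ (((d : ℝ) - 2) / 2)) / (2 * c) := by
  have := hμ.isProbabilityMeasure
  have := isProbabilityMeasure_empiricalMeasure hn x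
  have hM0 : 0 ≤ M := (norm_nonneg _).trans (hM 0)
  have hm0 := momentConstant_nonneg d
  have hC := robinConstant_ne_top hd hV.continuous hμ
  have hG0 : 0 ≤ longTimeBound d s := by unfold longTimeBound; positivity
  have hn0 : (0 : ℝ) < n := by positivity
  have hscr : ∀ t, 0 < t → screening q t ≤ 1 := fun t ht => by
    rw [← screening_add_coscreening hq.le ht]; exact le_self_add
  -- The long-time energy only controls weights below `longTime s`, so the short times are cut from
  -- the screened kernel as well.
  set v : ℝ → ℝ≥0∞ := fun t => longTime s t * screening q t with hv
  have hvm : Measurable v := by fun_prop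
  have hscr' : ∀ t, v t ≤ longTime s t := by
    intro t
    by_cases ht : s < t
    · exact (mul_le_mul_right (hscr t (hs.trans ht)) _).trans (by simp)
    · simp [hv, longTime, Set.indicator, ht]
  have hk : ∀ x y : Space d, mixtureKernel v x y
      ≤ ENNReal.ofReal (1 / q ^ (((d : ℝ) - 2) / 2)) := by
    intro x y
    refine (mixtureKernel_mono (w := screening q) (fun t _ => ?_) x y).trans ?_
    · exact (mul_le_mul_left (longTime_le_one s t) _).trans (by simp)
    · refine (mixtureKernel_le_self _ x y 0).trans ?_
      rw [mixtureKernel_screening hd hq]; simp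
  have hkz := hk z z
  have hG : ∀ x y : Space d, mixtureKernel (longTime s) x y
      ≤ ENNReal.ofReal (longTimeBound d s) := fun x y => mixtureKernel_longTime_le hd hs x y
  -- Duality in both orders (`d1`, `d2`) gives the two signs of the difference; `d3` and `d4` bound
  -- the long-time energy distance of the two measures by the excess energy. What remains is linear
  -- arithmetic, once the quantities are known to be finite.
  have d1 := interaction_add_potential_le hvm (measurable_longTime s) hscr'
    (empiricalMeasure x) μ z (ENNReal.ofReal c)
  have d2 := interaction_add_potential_le hvm (measurable_longTime s) hscr'
    μ (empiricalMeasure x) z (ENNReal.ofReal c)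
  rw [interaction_mixtureKernel_comm (by fun_prop) μ (empiricalMeasure x)] at d2
  have d3 := interaction_add_robinConstant_le hd hV hV0 hM hμ hn hx hs
  have d4 : interaction (mixtureKernel (longTime s)) μ μ ≤ interaction coulombKernel μ μ := by
    rw [coulombKernel_eq_mixtureKernel hd]
    exact lintegral_mono fun a => lintegral_mono fun b =>
      mixtureKernel_mono (fun t _ => longTime_le_one s t) a b
  have f1 := ne_top_of_le_ne_top ENNReal.ofReal_ne_top
    (interaction_le_of_le hG (empiricalMeasure x) (empiricalMeasure x))
  have f2 := ne_top_of_le_ne_top ENNReal.ofReal_ne_top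
    (interaction_le_of_le hG (empiricalMeasure x) μ)
  have f3 := ne_top_of_le_ne_top ENNReal.ofReal_ne_top (interaction_le_of_le hG μ μ)
  have f4 := ne_top_of_le_ne_top ENNReal.ofReal_ne_top
    (potential_le_of_le hk (empiricalMeasure x) z)
  have f5 := ne_top_of_le_ne_top ENNReal.ofReal_ne_top (potential_le_of_le hk μ z)
  have f6 := ne_top_of_le_ne_top ENNReal.ofReal_ne_top hkz
  have hH0 := discreteEnergy_nonneg hV0 n x
  obtain ⟨f7, f8⟩ := ENNReal.add_ne_top.1 hC
  have hninv : (n : ℝ≥0∞)⁻¹ = ENNReal.ofReal (n : ℝ)⁻¹ := by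
    rw [ENNReal.ofReal_inv_of_pos hn0, ENNReal.ofReal_natCast]
  unfold robinConstant at d3
  rw [hninv] at d3
  unfold realEnergy
  generalize interaction coulombKernel μ μ = A1 at *
  generalize (∫⁻ x, ENNReal.ofReal (V x) ∂μ) = A2 at *
  generalize interaction (mixtureKernel (longTime s)) (empiricalMeasure x) (empiricalMeasure x)
    = A3 at *
  generalize interaction (mixtureKernel (longTime s)) (empiricalMeasure x) μ = A4 at *
  generalize interaction (mixtureKernel (longTime s)) μ μ = A5 at *
  generalize potential (mixtureKernel v) (empiricalMeasure x) z = A6 at *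
  generalize potential (mixtureKernel v) μ z = A7 at *
  generalize mixtureKernel v z z = A8 at *
  generalize discreteEnergy V n x = H at *
  generalize longTimeBound d s = G at *
  have hE0 : 0 ≤ M * momentConstant d * s := by positivity
  generalize M * momentConstant d * s = E at *
  have hQ0 : 0 ≤ 1 / q ^ (((d : ℝ) - 2) / 2) := by positivity
  rw [div_eq_mul_one_div (c ^ 2) (q ^ (((d : ℝ) - 2) / 2)), div_eq_mul_inv G]
  generalize 1 / q ^ (((d : ℝ) - 2) / 2) = Q at *
  have hN0 : 0 ≤ (n : ℝ)⁻¹ := by positivity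
  generalize (n : ℝ)⁻¹ = N at *
  lift A1 to NNReal using f7
  lift A2 to NNReal using f8
  lift A3 to NNReal using f1
  lift A4 to NNReal using f2
  lift A5 to NNReal using f3
  lift A6 to NNReal using f4
  lift A7 to NNReal using f5
  lift A8 to NNReal using f6
  simp only [ENNReal.coe_toReal]
  lift H to NNReal using hH0
  lift G to NNReal using hG0
  lift E to NNReal using hE0
  lift Q to NNReal using hQ0
  lift N to NNReal using hN0
  lift c to NNReal using hc.le
  simp only [ENNReal.ofReal_coe_nnreal] at *
  norm_cast at d1 d2 d3 d4 hkz
  rw [← NNReal.coe_le_coe] at d1 d2 d3 d4 hkz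
  push_cast at d1 d2 d3 d4 hkz
  have hcQ : (c : ℝ) ^ 2 * A8 ≤ c ^ 2 * Q := by gcongr
  rw [le_div_iff₀ (by positivity), ← abs_of_pos (show (0 : ℝ) < 2 * c by positivity), ← abs_mul]
  refine abs_le.2 ⟨?_, ?_⟩ <;> nlinarith

/-- The bound on the part of the screened kernel that comes from times at most `s`. -/
def screeningTail (d : ℕ) (q s : ℝ) : ℝ :=
  Real.exp (-(q / (8 * s))) / (q / 2) ^ (((d : ℝ) - 2) / 2)

/-- The bound on the difference between the Coulomb potential of the equilibrium measure and its
regularization. -/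
def regularizationBound (V : Space d → ℝ) (μ : Measure (Space d)) (M q s : ℝ) : ℝ :=
  (doublingConstant d).toReal * (M * momentConstant d * s + q / (4 * s) * (robinConstant V μ).toReal)

/-- The distance between the regularized potential of a configuration and the Coulomb potential of
the equilibrium measure is controlled by the excess energy of the configuration. -/
theorem abs_potential_sub_le (hd : 3 ≤ d) {V : Space d → ℝ} (hV : ContDiff ℝ 2 V)
    (hV0 : ∀ x, 0 ≤ V x) {M : ℝ} (hM : ∀ x, ‖iteratedFDeriv ℝ 2 V x‖ ≤ M)
    {μ : Measure (Space d)} (hμ : IsEquilibriumMeasure V μ) (hac : μ ≪ volume) {n : ℕ} (hn : n ≠ 0)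
    {x : Fin n → Space d} (hx : Function.Injective x) {s q c r : ℝ} (hs : 0 < s) (hq : 0 < q)
    (hc : 0 < c) (hr : 0 < r) (z : Space d) :
    |(potential (mixtureKernel (screening q)) (empiricalMeasure x) z).toReal
        - (potential coulombKernel μ z).toReal|
      ≤ screeningTail d q s + regularizationBound V μ M q r
        + (2 * (discreteEnergy V n x - realEnergy V μ) + longTimeBound d s / n
          + 2 * (M * momentConstant d * s) + c ^ 2 / q ^ (((d : ℝ) - 2) / 2)) / (2 * c) := by
  have := hμ.isProbabilityMeasure
  have := isProbabilityMeasure_empiricalMeasure hn x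
  have hM0 : 0 ≤ M := (norm_nonneg _).trans (hM 0)
  have hm0 := momentConstant_nonneg d
  have hC := robinConstant_ne_top hd hV.continuous hμ
  have main := abs_potential_longTime_sub_le hd hV hV0 hM hμ hn hx hs hq hc z
  set v : ℝ → ℝ≥0∞ := fun t => longTime s t * screening q t with hv
  have hvm : Measurable v := by fun_prop
  have hT0 : 0 ≤ screeningTail d q s := by unfold screeningTail; positivity
  have hle : ∀ (ν : Measure (Space d)), potential (mixtureKernel v) ν z
      ≤ potential (mixtureKernel (screening q)) ν z := fun ν =>
    lintegral_mono fun y => mixtureKernel_mono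
      (fun t _ => (mul_le_mul_left (longTime_le_one s t) _).trans (by simp)) z y
  have hle' : ∀ (ν : Measure (Space d)), IsProbabilityMeasure ν →
      potential (mixtureKernel (screening q)) ν z
        ≤ potential (mixtureKernel v) ν z + ENNReal.ofReal (screeningTail d q s) := by
    intro ν _
    refine (lintegral_mono fun y => mixtureKernel_screening_le hd hq s z y).trans ?_
    rw [lintegral_add_left (by fun_prop)]
    simp [potential, screeningTail, hv]
  have hfin : ∀ (ν : Measure (Space d)), IsProbabilityMeasure ν →
      potential (mixtureKernel (screening q)) ν z ≠ ∞ := by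
    intro ν _
    refine ne_top_of_le_ne_top ENNReal.ofReal_ne_top (potential_le_of_le (fun x y => ?_) ν z)
      (b := ENNReal.ofReal (1 / q ^ (((d : ℝ) - 2) / 2)))
    refine (mixtureKernel_le_self _ x y 0).trans ?_
    rw [mixtureKernel_screening hd hq]; simp
  have hfin' : ∀ (ν : Measure (Space d)), IsProbabilityMeasure ν →
      potential (mixtureKernel v) ν z ≠ ∞ := fun ν hν => ne_top_of_le_ne_top (hfin ν hν) (hle ν)
  have hreal : ∀ (ν : Measure (Space d)), IsProbabilityMeasure ν →
      (potential (mixtureKernel v) ν z).toReal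
          ≤ (potential (mixtureKernel (screening q)) ν z).toReal ∧
        (potential (mixtureKernel (screening q)) ν z).toReal
          ≤ (potential (mixtureKernel v) ν z).toReal + screeningTail d q s := by
    intro ν hν
    refine ⟨ENNReal.toReal_mono (hfin ν hν) (hle ν), ?_⟩
    have h := ENNReal.toReal_mono (ENNReal.add_ne_top.2 ⟨hfin' ν hν, ENNReal.ofReal_ne_top⟩)
      (hle' ν hν)
    rwa [ENNReal.toReal_add (hfin' ν hν) ENNReal.ofReal_ne_top, ENNReal.toReal_ofReal hT0] at h
  have hW := potential_coulombKernel_eq_add hd hq.le μ z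
  have hWfin := potential_coulombKernel_ne_top hd hV.continuous hμ hac z
  have hco := potential_coscreening_le hd hV hV0 hM hμ hac hq.le hr z
  rw [hW] at hWfin
  have hD : doublingConstant d ≠ ∞ := ENNReal.ofReal_ne_top
  have hB := ENNReal.toReal_mono (ENNReal.mul_ne_top hD (ENNReal.add_ne_top.2
    ⟨ENNReal.ofReal_ne_top, ENNReal.mul_ne_top ENNReal.ofReal_ne_top hC⟩)) hco
  rw [ENNReal.toReal_mul, ENNReal.toReal_add ENNReal.ofReal_ne_top
    (ENNReal.mul_ne_top ENNReal.ofReal_ne_top hC), ENNReal.toReal_mul,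
    ENNReal.toReal_ofReal (show 0 ≤ M * momentConstant d * r by positivity),
    ENNReal.toReal_ofReal (show 0 ≤ q / (4 * r) by positivity)] at hB
  rw [hW, ENNReal.toReal_add (ENNReal.add_ne_top.1 hWfin).1 (ENNReal.add_ne_top.1 hWfin).2]
  -- The cutoff lowers both potentials, each by at most `screeningTail`, so this error enters the
  -- difference only once.
  have h1 := hreal μ inferInstance
  have h2 := hreal (empiricalMeasure x) inferInstance
  have h3 : 0 ≤ (potential (mixtureKernel (coscreening q)) μ z).toReal := ENNReal.toReal_nonneg
  have h4 := abs_le.1 main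
  unfold regularizationBound
  refine abs_le.2 ⟨?_, ?_⟩ <;> linarith [h1.1, h1.2, h2.1, h2.2, h4.1, h4.2]

/-! ### Product measures and the lower bound for the partition function. -/

theorem lintegral_fin_prod {α : Type*} [MeasurableSpace α] {m : Measure α} [SigmaFinite m] {n : ℕ}
    {f : Fin n → α → ℝ≥0∞} (hf : ∀ i, Measurable (f i)) :
    ∫⁻ x, ∏ i, f i (x i) ∂Measure.pi (fun _ : Fin n => m) = ∏ i, ∫⁻ y, f i y ∂m := by
  induction n with
  | zero => simp
  | succ n ih =>
    have h := (measurePreserving_piFinSuccAbove (fun _ : Fin (n + 1) => m) 0).symm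
    rw [← h.lintegral_comp_emb (MeasurableEquiv.measurableEmbedding _)]
    simp only [MeasurableEquiv.piFinSuccAbove_symm_apply, Fin.insertNthEquiv,
      Fin.prod_univ_succ, Fin.insertNth_zero, Equiv.coe_fn_mk, Fin.cons_succ, Fin.cons_zero]
    have h2 : Measurable fun x : Fin n → α => ∏ i : Fin n, f i.succ (x i) :=
      Finset.measurable_prod _ fun i _ => (hf _).comp (measurable_pi_apply i)
    rw [← ih fun i => hf i.succ]
    exact lintegral_prod_mul (f := f 0) (g := fun x : Fin n → α => ∏ i : Fin n, f i.succ (x i))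
      (hf 0).aemeasurable h2.aemeasurable

theorem pi_withDensity {α : Type*} [MeasurableSpace α] {m : Measure α} [SigmaFinite m]
    {f : α → ℝ≥0∞} (hf : Measurable f) [SigmaFinite (m.withDensity f)] (n : ℕ) :
    Measure.pi (fun _ : Fin n => m.withDensity f)
      = (Measure.pi fun _ : Fin n => m).withDensity fun x => ∏ i, f (x i) := by
  refine Measure.pi_eq fun s hs => ?_
  rw [withDensity_apply _ (MeasurableSet.univ_pi hs),
    ← lintegral_indicator (MeasurableSet.univ_pi hs)]
  have h : ∀ x : Fin n → α, (Set.univ.pi s).indicator (fun x => ∏ i, f (x i)) x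
      = ∏ i, (s i).indicator f (x i) := by
    intro x
    by_cases hx : x ∈ Set.univ.pi s
    · rw [Set.indicator_of_mem hx]
      exact Finset.prod_congr rfl fun i _ => (Set.indicator_of_mem (hx i trivial) f).symm
    · rw [Set.indicator_of_notMem hx]
      simp only [Set.mem_pi, Set.mem_univ, true_imp_iff, not_forall] at hx
      obtain ⟨i, hi⟩ := hx
      exact (Finset.prod_eq_zero (Finset.mem_univ i) (Set.indicator_of_notMem hi f)).symm
  simp only [h]
  rw [lintegral_fin_prod fun i => hf.indicator (hs i)]
  refine Finset.prod_congr rfl fun i _ => ?_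
  rw [lintegral_indicator (hs i), withDensity_apply _ (hs i)]

theorem lintegral_pi_pair {α : Type*} [MeasurableSpace α] {m : Measure α} [IsProbabilityMeasure m]
    {n : ℕ} {i j : Fin n} (hij : i ≠ j) {f : α → α → ℝ≥0∞} (hf : Measurable (Function.uncurry f)) :
    ∫⁻ x, f (x i) (x j) ∂Measure.pi (fun _ : Fin n => m) = ∫⁻ y, ∫⁻ z, f y z ∂m ∂m := by
  have h1 : iIndepFun (fun (i : Fin n) (x : Fin n → α) => x i) (Measure.pi fun _ : Fin n => m) :=
    iIndepFun_pi (X := fun _ => id) fun _ => aemeasurable_id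
  have h2 := (indepFun_iff_map_prod_eq_prod_map_map
    (measurable_pi_apply i).aemeasurable (measurable_pi_apply j).aemeasurable).1
    (h1.indepFun hij)
  have hmap : ∀ k : Fin n, (Measure.pi fun _ : Fin n => m).map (fun x => x k) = m := fun k =>
    (measurePreserving_eval (fun _ : Fin n => m) k).map_eq
  rw [hmap, hmap] at h2
  calc _ = ∫⁻ p, Function.uncurry f p ∂((Measure.pi fun _ : Fin n => m).map
        fun x => (x i, x j)) := by
        rw [lintegral_map hf (by fun_prop)]; rfl
    _ = _ := by rw [h2, lintegral_prod _ hf.aemeasurable]; rfl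

@[fun_prop]
theorem measurable_coulombKernel_comp {α : Type*} [MeasurableSpace α] {f g : α → Space d}
    (hf : Measurable f) (hg : Measurable g) :
    Measurable fun a => coulombKernel (f a) (g a) := by
  unfold coulombKernel
  exact ((hf.edist hg).pow_const _).inv

theorem measurable_discreteEnergy {V : Space d → ℝ} (hV : Measurable V) (n : ℕ) :
    Measurable (discreteEnergy V n) := by
  unfold discreteEnergy
  refine ((Finset.measurable_sum _ fun i _ => Finset.measurable_sum _ fun j _ => ?_).const_mul
    _).add ((Finset.measurable_sum _ fun i _ => by fun_prop).const_mul _)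
  split_ifs <;> fun_prop

/-- Distinct coordinates are independent, so each off-diagonal pair contributes the interaction of
`μ`; the zero diagonal is bounded by it as well, which turns `n (n - 1)` into `n²`. -/
theorem lintegral_ofReal_discreteEnergy_le {V : Space d → ℝ} (hV : Measurable V)
    (hV0 : ∀ x, 0 ≤ V x) {μ : Measure (Space d)} [IsProbabilityMeasure μ] {n : ℕ} (hn : n ≠ 0) :
    ∫⁻ x, ENNReal.ofReal (discreteEnergy V n x) ∂Measure.pi (fun _ : Fin n => μ)
      ≤ 2⁻¹ * interaction coulombKernel μ μ + ∫⁻ x, ENNReal.ofReal (V x) ∂μ := by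
  have hn0 : (0 : ℝ) < n := by positivity
  have hn' : (n : ℝ≥0∞)⁻¹ * n = 1 :=
    ENNReal.inv_mul_cancel (by exact_mod_cast hn) (ENNReal.natCast_ne_top n)
  have hinv : ENNReal.ofReal (1 / (n : ℝ)) = (n : ℝ≥0∞)⁻¹ := by
    rw [one_div, ENNReal.ofReal_inv_of_pos hn0, ENNReal.ofReal_natCast]
  have hinv2 : ENNReal.ofReal (1 / (2 * (n : ℝ) ^ 2)) = 2⁻¹ * ((n : ℝ≥0∞)⁻¹ * (n : ℝ≥0∞)⁻¹) := by
    rw [← hinv, ← ENNReal.ofReal_mul (by positivity), ← ENNReal.ofReal_ofNat,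
      ← ENNReal.ofReal_inv_of_pos two_pos, ← ENNReal.ofReal_mul (by positivity)]
    congr 1; field_simp
  have hpt : ∀ x : Fin n → Space d, ENNReal.ofReal (discreteEnergy V n x)
      ≤ 2⁻¹ * ((n : ℝ≥0∞)⁻¹ * (n : ℝ≥0∞)⁻¹)
          * (∑ i, ∑ j, if i ≠ j then coulombKernel (x i) (x j) else 0)
        + (n : ℝ≥0∞)⁻¹ * ∑ i, ENNReal.ofReal (V (x i)) := by
    intro x
    unfold discreteEnergy
    refine ENNReal.ofReal_add_le.trans ?_
    rw [ENNReal.ofReal_mul (by positivity), ENNReal.ofReal_mul (by positivity), hinv, hinv2,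
      ENNReal.ofReal_sum_of_nonneg fun i _ => hV0 _]
    gcongr
    have hterm : ∀ i j, 0 ≤ (if i ≠ j then (coulombKernel (x i) (x j)).toReal else 0) := by
      intro i j; split_ifs <;> positivity
    rw [ENNReal.ofReal_sum_of_nonneg fun i _ => Finset.sum_nonneg fun j _ => hterm i j]
    refine Finset.sum_le_sum fun i _ => ?_
    rw [ENNReal.ofReal_sum_of_nonneg fun j _ => hterm i j]
    refine Finset.sum_le_sum fun j _ => ?_
    split_ifs
    · exact ENNReal.ofReal_toReal_le
    · simp
  have hm : ∀ i j : Fin n, Measurable fun x : Fin n → Space d =>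
      if i ≠ j then coulombKernel (x i) (x j) else 0 := by
    intro i j; split_ifs <;> fun_prop
  have hpair : ∀ i j : Fin n, ∫⁻ x, (if i ≠ j then coulombKernel (x i) (x j) else 0)
      ∂Measure.pi (fun _ : Fin n => μ) ≤ interaction coulombKernel μ μ := by
    intro i j
    by_cases hij : i = j
    · simp [hij]
    · simp only [ne_eq, hij, not_false_eq_true, if_true]
      rw [lintegral_pi_pair hij (f := coulombKernel)]
      · rfl
      · exact measurable_coulombKernel_comp measurable_fst measurable_snd
  have hone : ∀ i : Fin n, ∫⁻ x, ENNReal.ofReal (V (x i)) ∂Measure.pi (fun _ : Fin n => μ)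
      = ∫⁻ y, ENNReal.ofReal (V y) ∂μ := fun i =>
    (measurePreserving_eval (fun _ : Fin n => μ) i).lintegral_comp hV.ennreal_ofReal
  refine (lintegral_mono hpt).trans ?_
  rw [lintegral_add_right _ (by fun_prop), lintegral_const_mul _
    (Finset.measurable_sum _ fun i _ => Finset.measurable_sum _ fun j _ => hm i j),
    lintegral_const_mul _ (by fun_prop),
    lintegral_finsetSum _ fun i _ => Finset.measurable_sum _ fun j _ => hm i j,
    lintegral_finsetSum Finset.univ (f := fun i (x : Fin n → Space d) => ENNReal.ofReal (V (x i)))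
      fun i _ => by fun_prop]
  simp only [hone, Finset.sum_const, Finset.card_univ, Fintype.card_fin, nsmul_eq_mul]
  rw [← mul_assoc (n : ℝ≥0∞)⁻¹, hn', one_mul]
  refine add_le_add ?_ le_rfl
  calc _ ≤ 2⁻¹ * ((n : ℝ≥0∞)⁻¹ * (n : ℝ≥0∞)⁻¹)
        * ∑ i : Fin n, ∑ j : Fin n, interaction coulombKernel μ μ := by
        gcongr with i
        rw [lintegral_finsetSum _ fun j _ => hm i j]
        gcongr with j
        exact hpair i j
    _ = 2⁻¹ * (((n : ℝ≥0∞)⁻¹ * n) * ((n : ℝ≥0∞)⁻¹ * n) * interaction coulombKernel μ μ) := by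
        simp only [Finset.sum_const, Finset.card_univ, Fintype.card_fin, nsmul_eq_mul]; ring
    _ = _ := by rw [hn', one_mul, one_mul]

/-- Jensen's inequality for the exponential. -/
theorem ofReal_exp_integral_le {α : Type*} [MeasurableSpace α] {m : Measure α}
    [IsProbabilityMeasure m] {f : α → ℝ} (hf : Integrable f m) :
    ENNReal.ofReal (Real.exp (∫ x, f x ∂m)) ≤ ∫⁻ x, ENNReal.ofReal (Real.exp (f x)) ∂m := by
  set c := ∫ x, f x ∂m with hc
  -- The tangent line of `exp` at the mean `c` is integrated. Its positive part still lies below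
  -- `exp` and can be passed to a `lintegral`.
  have hi : Integrable (fun x => Real.exp c * (1 + (f x - c))) m :=
    ((integrable_const _).add (hf.sub (integrable_const _))).const_mul _
  have h1 : ∫ x, Real.exp c * (1 + (f x - c)) ∂m = Real.exp c := by
    have hfc : Integrable (fun x => f x - c) m := hf.sub (integrable_const _)
    rw [integral_const_mul, integral_add (integrable_const _) hfc, integral_sub hf (integrable_const _)]
    simp [hc]
  calc _ = ENNReal.ofReal (∫ x, Real.exp c * (1 + (f x - c)) ∂m) := by rw [h1]
    _ ≤ ENNReal.ofReal (∫ x, max (Real.exp c * (1 + (f x - c))) 0 ∂m) :=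
        ENNReal.ofReal_le_ofReal (integral_mono hi hi.pos_part fun x => le_max_left _ _)
    _ = ∫⁻ x, ENNReal.ofReal (max (Real.exp c * (1 + (f x - c))) 0) ∂m :=
        ofReal_integral_eq_lintegral_ofReal hi.pos_part
          (Eventually.of_forall fun x => le_max_right _ _)
    _ ≤ _ := by
        refine lintegral_mono fun x => ENNReal.ofReal_le_ofReal (max_le ?_ (Real.exp_nonneg _))
        have := Real.add_one_le_exp (f x - c)
        calc _ ≤ Real.exp c * Real.exp (f x - c) := by gcongr; linarith
          _ = _ := by rw [← Real.exp_add]; congr 1; ring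

/-- The entropy `∫ log ρ dμ` of a measure with Lebesgue density `ρ`. -/
def entropy (μ : Measure (Space d)) : ℝ := ∫ x, Real.log (μ.rnDeriv volume x).toReal ∂μ

/-- The Gibbs variational principle with the product measure as trial law: dividing by the density
inserts `exp (-∑ log ρ)`, and Jensen bounds the result by the mean energy and the entropy. -/
theorem ofReal_exp_le_partitionFunction {V : Space d → ℝ} (hV : Measurable V)
    (hV0 : ∀ x, 0 ≤ V x) {μ : Measure (Space d)} [IsProbabilityMeasure μ]
    (hfin : robinConstant V μ ≠ ∞) (hent : HasFiniteEntropy μ) {n : ℕ} (hn : n ≠ 0) {β : ℝ}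
    (hβ : 0 ≤ β) :
    ENNReal.ofReal (Real.exp (-β * realEnergy V μ - n * entropy μ)) ≤ partitionFunction V n β := by
  obtain ⟨hfin1, hfin2⟩ := ENNReal.add_ne_top.1 hfin
  set ρ : Space d → ℝ := fun x => (μ.rnDeriv volume x).toReal with hρ
  have hρm : Measurable ρ := (Measure.measurable_rnDeriv _ _).ennreal_toReal
  have hρ0 : ∀ x, 0 ≤ ρ x := fun x => ENNReal.toReal_nonneg
  have hμρ : volume.withDensity (fun x => ENNReal.ofReal (ρ x)) = μ := by
    refine (withDensity_congr_ae ?_).trans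
      (Measure.withDensity_rnDeriv_eq μ volume hent.absolutelyContinuous)
    filter_upwards [Measure.rnDeriv_lt_top μ volume] with x hx
    exact ENNReal.ofReal_toReal hx.ne
  have hpi : Measure.pi (fun _ : Fin n => μ)
      = (volume : Measure (Fin n → Space d)).withDensity fun x =>
        ∏ i, ENNReal.ofReal (ρ (x i)) := by
    have : SigmaFinite (volume.withDensity fun x : Space d => ENNReal.ofReal (ρ x)) := by
      rw [hμρ]; infer_instance
    have h := pi_withDensity (m := (volume : Measure (Space d))) hρm.ennreal_ofReal n
    rw [hμρ] at h
    exact h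
  have hH := measurable_discreteEnergy hV n
  have hbound := lintegral_ofReal_discreteEnergy_le hV hV0 (μ := μ) hn
  have htop : 2⁻¹ * interaction coulombKernel μ μ + ∫⁻ x, ENNReal.ofReal (V x) ∂μ ≠ ∞ :=
    ENNReal.add_ne_top.2 ⟨ENNReal.mul_ne_top (by simp) hfin1, hfin2⟩
  have hHnn : 0 ≤ᵐ[Measure.pi (fun _ : Fin n => μ)] discreteEnergy V n :=
    Eventually.of_forall fun x => discreteEnergy_nonneg hV0 n x
  have hHi : Integrable (discreteEnergy V n) (Measure.pi fun _ : Fin n => μ) := by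
    refine ⟨hH.aestronglyMeasurable, ?_⟩
    rw [hasFiniteIntegral_iff_ofReal hHnn]
    exact hbound.trans_lt htop.lt_top
  have hHle : ∫ x, discreteEnergy V n x ∂Measure.pi (fun _ : Fin n => μ) ≤ realEnergy V μ := by
    rw [integral_eq_lintegral_of_nonneg_ae hHnn hH.aestronglyMeasurable]
    refine (ENNReal.toReal_mono htop hbound).trans_eq ?_
    rw [ENNReal.toReal_add (ENNReal.mul_ne_top (by simp) hfin1) hfin2, ENNReal.toReal_mul]
    simp [realEnergy]; ring
  have hli : ∀ i : Fin n, Integrable (fun x : Fin n → Space d => Real.log (ρ (x i)))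
      (Measure.pi fun _ : Fin n => μ) := fun i =>
    (measurePreserving_eval (fun _ : Fin n => μ) i).integrable_comp_of_integrable hent.integrable_log
  have hlint : ∀ i : Fin n, ∫ x, Real.log (ρ (x i)) ∂(Measure.pi fun _ : Fin n => μ)
      = entropy μ := by
    intro i
    have h := integral_map (μ := Measure.pi fun _ : Fin n => μ) (φ := fun x => x i)
      (measurable_pi_apply i).aemeasurable (f := fun y => Real.log (ρ y)) hρm.log.aestronglyMeasurable
    rw [(measurePreserving_eval (fun _ : Fin n => μ) i).map_eq] at h
    exact h.symm
  have hi : Integrable (fun x => -β * discreteEnergy V n x - ∑ i, Real.log (ρ (x i)))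
      (Measure.pi fun _ : Fin n => μ) :=
    (hHi.const_mul _).sub (integrable_finsetSum _ fun i _ => hli i)
  have hint : ∫ x, (-β * discreteEnergy V n x - ∑ i, Real.log (ρ (x i)))
      ∂(Measure.pi fun _ : Fin n => μ)
      = -β * ∫ x, discreteEnergy V n x ∂(Measure.pi fun _ : Fin n => μ) - n * entropy μ := by
    rw [integral_sub (hHi.const_mul _) (integrable_finsetSum _ fun i _ => hli i),
      integral_const_mul, integral_finsetSum _ fun i _ => hli i]
    simp [hlint]
  have hmeas : Measurable fun x : Fin n → Space d => ENNReal.ofReal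
      (Real.exp (-β * discreteEnergy V n x - ∑ i, Real.log (ρ (x i)))) := by
    fun_prop
  calc _ ≤ ENNReal.ofReal (Real.exp (∫ x, (-β * discreteEnergy V n x - ∑ i, Real.log (ρ (x i)))
        ∂(Measure.pi fun _ : Fin n => μ))) := by
        rw [hint]
        refine ENNReal.ofReal_le_ofReal (Real.exp_le_exp.2 ?_)
        nlinarith
    _ ≤ ∫⁻ x, ENNReal.ofReal (Real.exp (-β * discreteEnergy V n x - ∑ i, Real.log (ρ (x i))))
        ∂(Measure.pi fun _ : Fin n => μ) := ofReal_exp_integral_le hi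
    _ ≤ partitionFunction V n β := by
        rw [hpi, lintegral_withDensity_eq_lintegral_mul _ (by fun_prop) hmeas]
        refine lintegral_mono fun x => ?_
        simp only [Pi.mul_apply, boltzmannWeight]
        rw [← ENNReal.ofReal_prod_of_nonneg fun i _ => hρ0 _,
          ← ENNReal.ofReal_mul (Finset.prod_nonneg fun i _ => hρ0 _)]
        refine ENNReal.ofReal_le_ofReal ?_
        rw [sub_eq_add_neg, Real.exp_add, ← Finset.sum_neg_distrib, Real.exp_sum, mul_left_comm,
          ← Finset.prod_mul_distrib]
        refine mul_le_of_le_one_right (Real.exp_nonneg _)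
          (Finset.prod_le_one (fun i _ => mul_nonneg (hρ0 _) (Real.exp_nonneg _)) fun i _ => ?_)
        -- Where `ρ = 0` the product is `0`, whatever the value of `Real.log 0`.
        rcases (hρ0 (x i)).eq_or_lt with h | h
        · simp [← h]
        · rw [Real.exp_neg, Real.exp_log h, mul_inv_cancel₀ h.ne']

/-! ### Concentration of the energy and almost sure injectivity. -/

/-- Large excess energies have exponentially small probability under the Gibbs measure. -/
theorem gibbsMeasure_energy_ge_le {V : Space d → ℝ} (hV : Measurable V)
    (hV0 : ∀ x, 0 ≤ V x) {μ : Measure (Space d)} [IsProbabilityMeasure μ]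
    (hfin : robinConstant V μ ≠ ∞) (hent : HasFiniteEntropy μ) {θ : ℝ} (hθ : 0 < θ)
    (hint : Integrable fun x => Real.exp (-θ * V x)) {n : ℕ} (hn : n ≠ 0) {β η : ℝ}
    (hβ : θ * n ≤ β) :
    gibbsMeasure V n β {x | realEnergy V μ + η ≤ discreteEnergy V n x}
      ≤ ENNReal.ofReal (Real.exp (n * (entropy μ + θ * realEnergy V μ + ∫ x, Real.exp (-θ * V x))
          - (β - θ * n) * η)) := by
  have hn0 : (0 : ℝ) < n := by positivity
  have hH := measurable_discreteEnergy hV n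
  have hms : MeasurableSet {x | realEnergy V μ + η ≤ discreteEnergy V n x} :=
    measurableSet_le measurable_const hH
  have hZ := ofReal_exp_le_partitionFunction hV hV0 hfin hent hn (β := β)
    (le_trans (by positivity) hβ)
  set I := realEnergy V μ with hI
  set K := ∫ x, Real.exp (-θ * V x) with hK
  have hK0 : 0 ≤ K := integral_nonneg fun x => Real.exp_nonneg _
  have hexp : ∫⁻ x, ENNReal.ofReal (Real.exp (-θ * V x)) = ENNReal.ofReal K :=
    (ofReal_integral_eq_lintegral_ofReal hint
      (Eventually.of_forall fun x => Real.exp_nonneg _)).symm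
  -- The part `θ n` of the inverse temperature is spent, through `∑ V ≤ n H`, on integrability; the
  -- rest, `β - θ n`, acts on the excess energy.
  have hpt : ∀ x : Fin n → Space d, I + η ≤ discreteEnergy V n x →
      boltzmannWeight V n β x ≤ ENNReal.ofReal (Real.exp (-(β - θ * n) * (I + η)))
        * ∏ i, ENNReal.ofReal (Real.exp (-θ * V (x i))) := by
    intro x hx
    have h1 : ∑ i, V (x i) ≤ n * discreteEnergy V n x := by
      unfold discreteEnergy
      have : 0 ≤ ∑ i : Fin n, ∑ j : Fin n,
          if i ≠ j then (coulombKernel (x i) (x j)).toReal else 0 :=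
        Finset.sum_nonneg fun i _ => Finset.sum_nonneg fun j _ => by split_ifs <;> positivity
      rw [mul_add, ← mul_assoc (n : ℝ) (1 / n), mul_one_div_cancel hn0.ne', one_mul]
      have : 0 ≤ (n : ℝ) * (1 / (2 * (n : ℝ) ^ 2) * ∑ i : Fin n, ∑ j : Fin n,
          if i ≠ j then (coulombKernel (x i) (x j)).toReal else 0) := by positivity
      linarith
    rw [boltzmannWeight, ← ENNReal.ofReal_prod_of_nonneg fun i _ => Real.exp_nonneg _,
      ← ENNReal.ofReal_mul (Real.exp_nonneg _), ← Real.exp_sum, ← Finset.mul_sum, ← Real.exp_add]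
    refine ENNReal.ofReal_le_ofReal (Real.exp_le_exp.2 ?_)
    have h2 : (β - θ * n) * (I + η) ≤ (β - θ * n) * discreteEnergy V n x :=
      mul_le_mul_of_nonneg_left hx (by linarith)
    have h3 : θ * ∑ i, V (x i) ≤ θ * (n * discreteEnergy V n x) := by gcongr
    linarith
  have hnum : (volume.withDensity (boltzmannWeight V n β))
      {x | I + η ≤ discreteEnergy V n x}
      ≤ ENNReal.ofReal (Real.exp (-(β - θ * n) * (I + η))) * ENNReal.ofReal K ^ n := by
    rw [withDensity_apply _ hms]
    refine (setLIntegral_mono' hms fun x hx => hpt x hx).trans ?_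
    refine (setLIntegral_le_lintegral _ _).trans ?_
    rw [lintegral_const_mul _ (by fun_prop), volume_pi,
      lintegral_fin_prod (f := fun _ y => ENNReal.ofReal (Real.exp (-θ * V y)))
        (fun i => by fun_prop)]
    simp only [hexp, Finset.prod_const, Finset.card_univ, Fintype.card_fin, le_refl]
  rw [gibbsMeasure, Measure.smul_apply, smul_eq_mul]
  calc _ ≤ (ENNReal.ofReal (Real.exp (-β * I - n * entropy μ)))⁻¹
        * (ENNReal.ofReal (Real.exp (-(β - θ * n) * (I + η))) * ENNReal.ofReal K ^ n) := by
        gcongr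
    _ = ENNReal.ofReal (Real.exp (-(-β * I - n * entropy μ))
        * (Real.exp (-(β - θ * n) * (I + η)) * K ^ n)) := by
        rw [← ENNReal.ofReal_inv_of_pos (Real.exp_pos _), ← ENNReal.ofReal_pow hK0,
          ← ENNReal.ofReal_mul (Real.exp_nonneg _), ← Real.exp_neg,
          ← ENNReal.ofReal_mul (Real.exp_nonneg _)]
    _ ≤ _ := by
        refine ENNReal.ofReal_le_ofReal ?_
        have h1 : K ^ n ≤ Real.exp (n * K) := by
          rw [Real.exp_nat_mul]
          gcongr
          linarith [Real.add_one_le_exp K]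
        calc _ ≤ Real.exp (-(-β * I - n * entropy μ))
              * (Real.exp (-(β - θ * n) * (I + η)) * Real.exp (n * K)) := by gcongr
          _ = _ := by rw [← Real.exp_add, ← Real.exp_add]; congr 1; ring

/-- Each coincidence set `x i = x j` is a proper linear subspace, hence a null set. -/
theorem ae_injective {n : ℕ} (hd : d ≠ 0) :
    ∀ᵐ x : Fin n → Space d, Function.Injective x := by
  have h : ∀ i j : Fin n, i ≠ j → ∀ᵐ x : Fin n → Space d, x i ≠ x j := by
    intro i j hij
    set L : (Fin n → Space d) →ₗ[ℝ] Space d := 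
      LinearMap.proj (R := ℝ) (φ := fun _ : Fin n => Space d) i
        - LinearMap.proj (R := ℝ) (φ := fun _ : Fin n => Space d) j with hL
    have hne : LinearMap.ker L ≠ ⊤ := by
      intro htop
      have : Nonempty (Fin d) := ⟨⟨0, Nat.pos_of_ne_zero hd⟩⟩
      obtain ⟨v, hv⟩ := exists_ne (0 : Space d)
      have h1 : Pi.single i v ∈ LinearMap.ker L := htop ▸ Submodule.mem_top
      rw [LinearMap.mem_ker] at h1
      simp [hL, hij.symm, hv] at h1
    have h0 := Measure.addHaar_submodule (volume : Measure (Fin n → Space d)) _ hne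
    rw [ae_iff]
    refine measure_mono_null (fun x hx => ?_) h0
    simp only [ne_eq, not_not, Set.mem_ofPred_eq] at hx
    simp [hL, hx]
  have h' : ∀ᵐ x : Fin n → Space d, ∀ i j, i ≠ j → x i ≠ x j := by
    simp only [ae_all_iff]
    exact h
  filter_upwards [h'] with x hx i j hij
  by_contra hne
  exact hx i j hne hij

/-! ### Choice of exponents and asymptotics of the error terms. -/

theorem tendsto_natCast_rpow_neg {p : ℝ} (hp : p < 0) :
    Tendsto (fun n : ℕ => (n : ℝ) ^ p) atTop (𝓝 0) := by
  have h := (tendsto_rpow_neg_atTop (neg_pos.2 hp)).comp tendsto_natCast_atTop_atTop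
  simpa [Function.comp_def] using h

theorem tendsto_natCast_rpow_atTop {p : ℝ} (hp : 0 < p) :
    Tendsto (fun n : ℕ => (n : ℝ) ^ p) atTop atTop :=
  (tendsto_rpow_atTop hp).comp tendsto_natCast_atTop_atTop

/-- The ratio `q / s = n^{2(a-ζ)}` is a positive power of `n`, and its exponential beats the power
in the denominator. -/
theorem tendsto_screeningTail {ζ a : ℝ} (ha : ζ < a) :
    Tendsto (fun n : ℕ => screeningTail d ((n : ℝ) ^ (-2 * ζ)) ((n : ℝ) ^ (-2 * a))) atTop
      (𝓝 0) := by
  set D : ℝ := ((d : ℝ) - 2) / 2 with hD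
  set p : ℝ := 2 * (a - ζ) with hp
  have hp0 : 0 < p := by linarith
  have h1 := ((tendsto_rpow_mul_exp_neg_mul_atTop_nhds_zero (2 * ζ * D / p) (1 / 8)
    (by norm_num)).comp (tendsto_natCast_rpow_atTop hp0)).const_mul ((2 : ℝ) ^ D)
  rw [mul_zero] at h1
  refine h1.congr' ?_
  filter_upwards [eventually_ne_atTop 0] with n hn
  have hn0 : (0 : ℝ) < n := by positivity
  have e1 : (n : ℝ) ^ (-2 * ζ) / (8 * (n : ℝ) ^ (-2 * a)) = 1 / 8 * (n : ℝ) ^ p := by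
    rw [show p = -2 * ζ - -2 * a by rw [hp]; ring, Real.rpow_sub hn0]; field_simp
  have e2 : ((n : ℝ) ^ (-2 * ζ) / 2) ^ D = (n : ℝ) ^ (-2 * ζ * D) / 2 ^ D := by
    rw [Real.div_rpow (by positivity) two_pos.le, ← Real.rpow_mul hn0.le]
  have e3 : ((n : ℝ) ^ p) ^ (2 * ζ * D / p) = ((n : ℝ) ^ (-2 * ζ * D))⁻¹ := by
    rw [← Real.rpow_mul hn0.le, ← Real.rpow_neg hn0.le]
    congr 1; field_simp
  simp only [Function.comp_apply]
  unfold screeningTail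
  rw [e1, ← hD, e2, e3, neg_mul]
  field_simp

/-- The cutoff is the square root of `q = n^{-2ζ}`, so both errors have order `n^{-ζ}`. -/
theorem regularizationBound_eq (V : Space d → ℝ) (μ : Measure (Space d)) (M ζ : ℝ) {n : ℕ}
    (hn : n ≠ 0) :
    regularizationBound V μ M ((n : ℝ) ^ (-2 * ζ)) ((n : ℝ) ^ (-ζ))
      = (doublingConstant d).toReal * (M * momentConstant d + (robinConstant V μ).toReal / 4)
        * (n : ℝ) ^ (-ζ) := by
  have hn0 : (0 : ℝ) < n := by positivity
  have e : (n : ℝ) ^ (-2 * ζ) = (n : ℝ) ^ (-ζ) * (n : ℝ) ^ (-ζ) := by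
    rw [← Real.rpow_add hn0]; congr 1; ring
  have : (n : ℝ) ^ (-ζ) ≠ 0 := by positivity
  unfold regularizationBound
  rw [e]; field_simp

/-- The parameter `c = τ n^{-ζ(d-2)}` is scaled so that the self-interaction term `c² / q^{(d-2)/2}`
contributes exactly `τ / 2`. -/
theorem excessBound_eq {ζ a b τ K : ℝ} (hτ : 0 < τ) {n : ℕ} (hn : n ≠ 0) :
    (2 * (n : ℝ) ^ (-b) + longTimeBound d ((n : ℝ) ^ (-2 * a)) / n + 2 * (K * (n : ℝ) ^ (-2 * a))
        + (τ * (n : ℝ) ^ (-(ζ * ((d : ℝ) - 2)))) ^ 2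
          / ((n : ℝ) ^ (-2 * ζ)) ^ (((d : ℝ) - 2) / 2))
      / (2 * (τ * (n : ℝ) ^ (-(ζ * ((d : ℝ) - 2)))))
      = 1 / τ * (n : ℝ) ^ (ζ * ((d : ℝ) - 2) - b)
        + Real.exp (1 / 4) / (2 * τ) * (n : ℝ) ^ (ζ * ((d : ℝ) - 2) + a * ((d : ℝ) - 2) - 1)
        + K / τ * (n : ℝ) ^ (ζ * ((d : ℝ) - 2) - 2 * a) + τ / 2 := by
  have hn0 : (0 : ℝ) < n := by positivity
  set κ := ζ * ((d : ℝ) - 2) with hκ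
  have e1 : ((n : ℝ) ^ (-2 * ζ)) ^ (((d : ℝ) - 2) / 2) = (n : ℝ) ^ (-κ) := by
    rw [← Real.rpow_mul hn0.le]; congr 1; rw [hκ]; ring
  have e2 : ((n : ℝ) ^ (-2 * a)) ^ (((d : ℝ) - 2) / 2) = ((n : ℝ) ^ (a * ((d : ℝ) - 2)))⁻¹ := by
    rw [← Real.rpow_mul hn0.le, ← Real.rpow_neg hn0.le]; congr 1; ring
  unfold longTimeBound
  rw [e1, e2, show κ - b = κ + -b by ring, show κ - 2 * a = κ + -2 * a by ring,
    Real.rpow_sub_one hn0.ne', Real.rpow_add hn0, Real.rpow_add hn0, Real.rpow_add hn0,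
    Real.rpow_neg hn0.le κ]
  have h1 : (n : ℝ) ^ κ ≠ 0 := by positivity
  have h2 : (n : ℝ) ^ (a * ((d : ℝ) - 2)) ≠ 0 := by positivity
  field_simp

/-- The gain `β_n n^{-b}` is at least `u n^{1+δ-b}`, which dominates all terms linear in `n` because
`b < δ`. -/
theorem eventually_exp_le_exp_neg {u δ b θ A : ℝ} (hu : 0 < u) (hb0 : 0 < b) (hb : b < δ)
    {β : ℕ → ℝ} (hβ : ∀ n : ℕ, 2 ≤ n → u * (n : ℝ) ^ (1 + δ) ≤ β n) :
    ∀ᶠ n : ℕ in atTop, θ * n ≤ β n ∧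
      Real.exp (n * A - (β n - θ * n) * (n : ℝ) ^ (-b)) ≤ Real.exp (-(n : ℝ)) := by
  have h1 : Tendsto (fun n : ℕ => u * (n : ℝ) ^ (δ - b) - θ * (n : ℝ) ^ (-b)) atTop atTop := by
    have h2 := ((tendsto_natCast_rpow_neg (neg_lt_zero.2 hb0)).const_mul θ).neg
    exact ((tendsto_natCast_rpow_atTop (sub_pos.2 hb)).const_mul_atTop hu).atTop_add h2
  have h3 := (tendsto_natCast_rpow_atTop (hb0.trans hb)).const_mul_atTop hu
  filter_upwards [h1.eventually_ge_atTop (A + 1), h3.eventually_ge_atTop θ, eventually_ge_atTop 2]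
    with n hn hn' hn2
  have hn0 : (0 : ℝ) < n := by positivity
  have hβn := hβ n hn2
  rw [Real.rpow_add hn0, Real.rpow_one] at hβn
  refine ⟨?_, Real.exp_le_exp.2 ?_⟩
  · calc θ * n ≤ u * (n : ℝ) ^ δ * n := by gcongr
      _ ≤ _ := by linarith
  · have h4 : (n : ℝ) ^ (δ - b) = (n : ℝ) ^ δ * (n : ℝ) ^ (-b) := by
      rw [← Real.rpow_add hn0]; congr 1
    have h5 : (n : ℝ) * (A + 1) ≤ n * (u * (n : ℝ) ^ (δ - b) - θ * (n : ℝ) ^ (-b)) := by gcongr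
    have h6 : u * (n * (n : ℝ) ^ δ) * (n : ℝ) ^ (-b) ≤ β n * (n : ℝ) ^ (-b) := by gcongr
    rw [h4] at h5
    nlinarith

theorem gibbsMeasure_absolutelyContinuous (V : Space d → ℝ) (n : ℕ) (β : ℝ) :
    gibbsMeasure V n β ≪ volume :=
  (withDensity_absolutelyContinuous _ _).smul_left _

/-- Almost surely, the energy of the Coulomb gas is eventually close to its minimum. -/
theorem ae_eventually_discreteEnergy_lt {V : Space d → ℝ} (hV : IsConfinement V)
    {μ : Measure (Space d)} [IsProbabilityMeasure μ] (hfin : robinConstant V μ ≠ ∞)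
    (hent : HasFiniteEntropy μ) {u δ b : ℝ} (hu : 0 < u) (hb0 : 0 < b) (hb : b < δ)
    {β : ℕ → ℝ} (hβ : ∀ n : ℕ, 2 ≤ n → u * (n : ℝ) ^ (1 + δ) ≤ β n)
    {Ω : Type*} [MeasurableSpace Ω] {P : Measure Ω}
    {X : (n : ℕ) → Ω → Fin n → Space d}
    (hX : ∀ n : ℕ, 2 ≤ n → HasLaw (X n) (gibbsMeasure V n (β n)) P) :
    ∀ᵐ ω ∂P, ∀ᶠ n : ℕ in atTop,
      discreteEnergy V n (X n ω) < realEnergy V μ + (n : ℝ) ^ (-b) := by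
  obtain ⟨θ, hθ, hint⟩ := hV.integrable_exp
  have hVm := hV.continuous.measurable
  obtain ⟨N, hN⟩ := eventually_atTop.1 (eventually_exp_le_exp_neg (θ := θ)
    (A := entropy μ + θ * realEnergy V μ + ∫ x, Real.exp (-θ * V x)) hu hb0 hb hβ)
  -- The condition on `n` empties the finitely many early events, for which no bound is available.
  set S : ℕ → Set Ω := fun n => {ω | max N 2 ≤ n ∧
    realEnergy V μ + (n : ℝ) ^ (-b) ≤ discreteEnergy V n (X n ω)} with hS
  have hbound : ∀ n, P (S n) ≤ ENNReal.ofReal (Real.exp (-(n : ℝ))) := by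
    intro n
    by_cases hn : max N 2 ≤ n
    · have hn2 : 2 ≤ n := (le_max_right _ _).trans hn
      obtain ⟨h1, h2⟩ := hN n ((le_max_left _ _).trans hn)
      have hms : MeasurableSet {x | realEnergy V μ + (n : ℝ) ^ (-b) ≤ discreteEnergy V n x} :=
        measurableSet_le measurable_const (measurable_discreteEnergy hVm n)
      have h3 := (hX n hn2).measure_eq hms
      have h4 : S n = {ω | realEnergy V μ + (n : ℝ) ^ (-b) ≤ discreteEnergy V n (X n ω)} := by
        ext ω; simp only [hS, Set.mem_ofPred_eq, hn, true_and]
      rw [h4, h3]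
      exact (gibbsMeasure_energy_ge_le hVm hV.nonneg hfin hent hθ hint (by omega) h1).trans
        (ENNReal.ofReal_le_ofReal h2)
    · have h4 : S n = ∅ := by
        ext ω; simp only [hS, Set.mem_ofPred_eq, hn, false_and, Set.mem_empty_iff_false]
      rw [h4]; simp
  have hsum : ∑' n, P (S n) ≠ ∞ := by
    refine ne_top_of_le_ne_top ?_ (ENNReal.tsum_le_tsum hbound)
    exact Real.summable_exp_neg_nat.tsum_ofReal_ne_top
  -- The first Borel-Cantelli lemma needs no independence, hence nothing about the joint law.
  filter_upwards [ae_eventually_notMem hsum] with ω hω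
  filter_upwards [hω, eventually_ge_atTop (max N 2)] with n hn hn2
  by_contra hlt
  exact hn ⟨hn2, not_lt.1 hlt⟩

end CoulombGas

end

/-! ### The main theorem. -/

theorem mainTheorem3 {d : ℕ} (hd : 3 ≤ d)
    (V : EuclideanSpace ℝ (Fin d) → ℝ)
    (hV : CoulombGas.IsConfinement V)
    (hV2 : ContDiff ℝ 2 V)
    (hV2b : ∃ M : ℝ, ∀ x, ‖iteratedFDeriv ℝ 2 V x‖ ≤ M)
    (μV : Measure (EuclideanSpace ℝ (Fin d)))
    (hμV : CoulombGas.IsEquilibriumMeasure V μV)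
    (hent : CoulombGas.HasFiniteEntropy μV)
    (u δ ζ : ℝ) (hu : 0 < u) (hδ : 0 < δ)
    (β : ℕ → ℝ) (hβ : ∀ n : ℕ, 2 ≤ n → u * (n : ℝ) ^ (1 + δ) ≤ β n)
    (hζ : 0 < ζ) (hζ' : ζ < min δ (2 / ((d : ℝ) + 2)) / ((d : ℝ) - 2))
    {Ω : Type*} [MeasurableSpace Ω] (P : Measure Ω) [IsProbabilityMeasure P]
    (X : (n : ℕ) → Ω → Fin n → EuclideanSpace ℝ (Fin d))
    (hX : ∀ n : ℕ, 2 ≤ n → HasLaw (X n) (CoulombGas.gibbsMeasure V n (β n)) P) :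
    (∀ z, CoulombGas.potential CoulombGas.coulombKernel μV z ≠ ∞) ∧
    ∀ᵐ ω ∂P, Tendsto
      (fun n : ℕ => ⨆ z : EuclideanSpace ℝ (Fin d), ENNReal.ofReal
        |(CoulombGas.potential (CoulombGas.regularizedKernel n ζ)
            (CoulombGas.empiricalMeasure (X n ω)) z).toReal
          - (CoulombGas.potential CoulombGas.coulombKernel μV z).toReal|)
      atTop (𝓝 0) := by
  have hac := hent.absolutelyContinuous
  have := hμV.isProbabilityMeasure
  obtain ⟨M, hM⟩ := hV2b
  have hd' : (3 : ℝ) ≤ d := by exact_mod_cast hd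
  have hD : (0 : ℝ) < (d : ℝ) - 2 := by linarith
  have hd2 : (0 : ℝ) < (d : ℝ) + 2 := by linarith
  refine ⟨CoulombGas.potential_coulombKernel_ne_top hd hV.continuous hμV hac, ?_⟩
  rw [lt_div_iff₀ hD] at hζ'
  -- The excess energy will be at most `n^{-b}`: `b < δ` serves the concentration bound, and `ζ(d-2)
  -- < b` the passage from energy to potential.
  obtain ⟨b, hκb, hbm⟩ := exists_between hζ'
  have hκ0 : 0 < ζ * ((d : ℝ) - 2) := mul_pos hζ hD
  have hbδ := hbm.trans_le (min_le_left _ _)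
  have hb2 := hbm.trans_le (min_le_right _ _)
  -- The cutoff time is `s = n^{-2a}`, with the largest `a` such that `a(d-2) - 1 ≤ -2/(d+2)`, as
  -- the self-interaction term requires. It also satisfies `2a ≥ 2/(d+2)`, for the smoothing error,
  -- and `ζ < a`, for the screening tail.
  set a : ℝ := d / ((d + 2) * (d - 2)) with ha
  have haD : a * ((d : ℝ) - 2) = 1 - 2 / ((d : ℝ) + 2) := by rw [ha]; field_simp; ring
  have h2a : 2 / ((d : ℝ) + 2) ≤ 2 * a := by
    rw [ha, ← mul_div_assoc, div_le_div_iff₀ hd2 (by positivity)]; nlinarith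
  have hζa : ζ < a := by
    have h1 : 2 / ((d : ℝ) + 2) < 1 - 2 / ((d : ℝ) + 2) := by
      rw [lt_sub_iff_add_lt, ← add_div, div_lt_one hd2]; linarith
    refine lt_of_mul_lt_mul_right ?_ hD.le
    rw [haD]; linarith
  have hfin := CoulombGas.robinConstant_ne_top hd hV.continuous hμV
  have hinj : ∀ᵐ ω ∂P, ∀ n : ℕ, 2 ≤ n → Function.Injective (X n ω) := by
    rw [ae_all_iff]
    intro n
    by_cases hn : 2 ≤ n
    · have h := CoulombGas.gibbsMeasure_absolutelyContinuous V n (β n)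
        |>.ae_le (CoulombGas.ae_injective (d := d) (by omega))
      rw [← (hX n hn).map_eq] at h
      filter_upwards [ae_of_ae_map (hX n hn).aemeasurable h] with ω hω _
      exact hω
    · exact Eventually.of_forall fun ω h => absurd h hn
  filter_upwards [hinj, CoulombGas.ae_eventually_discreteEnergy_lt hV hfin hent hu
    (hκ0.trans hκb) hbδ hβ hX] with ω hω1 hω2
  rw [ENNReal.tendsto_nhds_zero]
  intro ε hε
  rcases eq_or_ne ε ∞ with rfl | hεtop
  · exact Eventually.of_forall fun n => le_top
  have hτ : 0 < ε.toReal := ENNReal.toReal_pos hε.ne' hεtop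
  -- The target accuracy enters through the duality parameter `c`; the error bound then tends to `τ
  -- / 2`, below `τ`.
  set τ := ε.toReal with hτdef
  have hlim : Tendsto (fun n : ℕ =>
      CoulombGas.screeningTail d ((n : ℝ) ^ (-2 * ζ)) ((n : ℝ) ^ (-2 * a))
      + (CoulombGas.doublingConstant d).toReal
          * (M * CoulombGas.momentConstant d + (CoulombGas.robinConstant V μV).toReal / 4)
          * (n : ℝ) ^ (-ζ)
      + (1 / τ * (n : ℝ) ^ (ζ * ((d : ℝ) - 2) - b)
        + Real.exp (1 / 4) / (2 * τ) * (n : ℝ) ^ (ζ * ((d : ℝ) - 2) + a * ((d : ℝ) - 2) - 1)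
        + M * CoulombGas.momentConstant d / τ * (n : ℝ) ^ (ζ * ((d : ℝ) - 2) - 2 * a) + τ / 2))
      atTop (𝓝 (τ / 2)) := by
    have l1 := CoulombGas.tendsto_screeningTail (d := d) hζa
    have l2 := (CoulombGas.tendsto_natCast_rpow_neg (neg_lt_zero.2 hζ)).const_mul
      ((CoulombGas.doublingConstant d).toReal
        * (M * CoulombGas.momentConstant d + (CoulombGas.robinConstant V μV).toReal / 4))
    have l3 := (CoulombGas.tendsto_natCast_rpow_neg (sub_neg.2 hκb)).const_mul (1 / τ)
    have l4 := (CoulombGas.tendsto_natCast_rpow_neg (p := ζ * ((d : ℝ) - 2) + a * ((d : ℝ) - 2) - 1)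
      (by rw [haD]; linarith)).const_mul (Real.exp (1 / 4) / (2 * τ))
    have l5 := (CoulombGas.tendsto_natCast_rpow_neg (p := ζ * ((d : ℝ) - 2) - 2 * a)
      (by linarith)).const_mul (M * CoulombGas.momentConstant d / τ)
    simpa using (l1.add l2).add (((l3.add l4).add l5).add_const (τ / 2))
  filter_upwards [hω2, hlim.eventually_le_const (half_lt_self hτ), eventually_ge_atTop 2]
    with n hn1 hn2 hn3
  have hn : n ≠ 0 := by omega
  have hn0 : (0 : ℝ) < n := by positivity
  refine iSup_le fun z => ?_
  rw [← ENNReal.ofReal_toReal hεtop]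
  refine ENNReal.ofReal_le_ofReal (le_trans ?_ hn2)
  have hker : (CoulombGas.regularizedKernel n ζ : EuclideanSpace ℝ (Fin d) → _ → _)
      = CoulombGas.mixtureKernel (CoulombGas.screening ((n : ℝ) ^ (-2 * ζ))) := by
    ext x y; exact CoulombGas.regularizedKernel_eq hd hn ζ x y
  rw [hker, ← CoulombGas.regularizationBound_eq V μV M ζ hn, ← CoulombGas.excessBound_eq hτ hn]
  refine (CoulombGas.abs_potential_sub_le hd hV2 hV.nonneg hM hμV hac hn (hω1 n hn3)
    (s := (n : ℝ) ^ (-2 * a)) (c := τ * (n : ℝ) ^ (-(ζ * ((d : ℝ) - 2)))) (r := (n : ℝ) ^ (-ζ))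
    (by positivity) (by positivity) (by positivity) (by positivity) z).trans ?_
  gcongr
  linarith
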